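/- Let $d\ge 1$, let $\mathcal S_{\mathrm{even}},\mathcal S_{\mathrm{odd}}\subset\mathbb R^d$, and let $V_{\mathrm{odd}},V_{\mathrm{even}}\subset\mathbb R^d$ be finite sets such that $x+v\in\mathcal S_{\mathrm{odd}}$ for $x\in\mathcal S_{\mathrm{even}}$, $v\in V_{\mathrm{odd}}$; $x+v\in\mathcal S_{\mathrm{even}}$ for $x\in\mathcal S_{\mathrm{odd}}$, $v\in V_{\mathrm{even}}$; $V_{\mathrm{odd}}=-V_{\mathrm{even}}$; $0\in\mathcal S_{\mathrm{even}}$; $V_{\mathrm{odd}}\cap V_{\mathrm{even}}=\emptyset$; and $m=\#V_{\mathrm{odd}}\ge 2$. Put $V=V_{\mathrm{odd}}\cup V_{\mathrm{even}}$, and write $W_k=V_{\mathrm{odd}}$ for odd $k$ and $W_k=V_{\mathrm{even}}$ for even $k$. Let $p,q\in[0,1]$. On a probability space let $X_1$ be uniformly distributed on $V_{\mathrm{odd}}$; for $n\ge1$ let $\mathcal U_n$ be uniformly distributed on $\{1,\dots,n\}$; and for $k\ge 2$ and $v\in V$ let $G_k(v)$ be a $W_k$-valued random variable such that, for $w\in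 W_k$, $$\mathbb P(G_k(v)=w)=\begin{cases}p & v\in W_k,\ w=v,\\ \frac{1-p}{m-1} & v\in W_k,\ w\ne v,\\ q & v\notin W_k,\ w=-v,\\ \frac{1-q}{m-1} & v\notin W_k,\ w\neq -v.\end{cases}$$ Assume that the $\sigma$-fields $\sigma(X_1)$, $\sigma(\mathcal U_1,\{G_2(v)\}_{v\in V})$, $\sigma(\mathcal U_2,\{G_3(v)\}_{v\in V}),\dots$ are independent, and that for each $n\ge1$ the variable $\mathcal U_n$ is independent of the family $\{G_{n+1}(v)\}_{v\in V}$. The elephant random walk is defined by $X_{n+1}=G_{n+1}(X_{\mathcal U_n})$ for $n\ge1$, $S_0=0$, and $S_n=X_1+\dots+X_n$ for $n\ge 1$. Put $$\alpha=\frac{mp-1}{m-1},\qquad \beta=\frac{mq-1}{m-1},\qquad \delta=\frac{\alpha-\beta}{2},\qquad \bar v=\frac1m\sum_{v\in V_{\mathrm{odd}}}v .$$ Assume that $\delta=\frac12$ (the critical regime). Then, as $n\to\infty$, $$\frac{S_n}{\sqrt{n\log n}}\ \longrightarrow\ \mathcal N_d\Bigl(0,\ \frac1m\sum_{v\in V_{\mathrm{odd}}}(v-\bar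 v)(v-\bar v)^\top\Bigr)\quad\text{in distribution,}$$ where the (possibly singular) covariance matrix is as displayed, and no condition on $\gamma=\frac{\alpha+\beta}{2}$ is imposed. -/

import Mathlib

open MeasureTheory ProbabilityTheory Filter Topology

open scoped Pointwise

namespace ERW

noncomputable section

/-- The standing assumptions on the state sets `Sev`, `Sodd` and on the finite sets `Vodd`, `Vev`
of admissible steps in `ℝ ^ d`, including that there are `m ≥ 2` odd steps. -/
structure IsStepSystem {d : ℕ} (Sev Sodd : Set (EuclideanSpace ℝ (Fin d)))
    (Vodd Vev : Finset (EuclideanSpace ℝ (Fin d))) : Prop where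
  add_mem_odd : ∀ x ∈ Sev, ∀ v ∈ Vodd, x + v ∈ Sodd
  add_mem_even : ∀ x ∈ Sodd, ∀ v ∈ Vev, x + v ∈ Sev
  odd_eq_neg_even : (Vodd : Set (EuclideanSpace ℝ (Fin d))) = -(Vev : Set _)
  zero_mem : 0 ∈ Sev
  disjoint : Disjoint Vodd Vev
  two_le_card : 2 ≤ Vodd.card

/-- The set of admissible values of the `k`-th step: `Vodd` for odd `k`, `Vev` for even `k`. -/
def stepSet {d : ℕ} (Vodd Vev : Finset (EuclideanSpace ℝ (Fin d))) (k : ℕ) :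
    Finset (EuclideanSpace ℝ (Fin d)) :=
  if Odd k then Vodd else Vev

open Classical in
/-- The probability that a remembered step `v ∈ Vodd ∪ Vev` is turned into the step `w ∈ W`, where
`W` is the set (`Vodd` or `Vev`) in which the new step has to lie. If `v` lies in `W`, then `v`
itself is repeated with probability `p`; if `v` lies in the other set, then `-v` is taken with
probability `q`; the remaining mass is spread evenly over the other elements of `W`. -/
def jumpProb {d : ℕ} (p q : ℝ) (W : Finset (EuclideanSpace ℝ (Fin d)))
    (v w : EuclideanSpace ℝ (Fin d)) : ℝ :=
  if v ∈ W then
    if v = w then p else (1 - p) / ((W.card : ℝ) - 1)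
  else
    if -v = w then q else (1 - q) / ((W.card : ℝ) - 1)

/-- The `σ`-algebras generated by the successive sources of randomness: index `0` is `σ(X₁)`, and
index `n ≥ 1` is `σ(U n, (G (n + 1) v) for v ∈ Vodd ∪ Vev)`. -/
def innovation {d : ℕ} {Ω : Type*} (Vodd Vev : Finset (EuclideanSpace ℝ (Fin d)))
    (X₁ : Ω → EuclideanSpace ℝ (Fin d)) (U : ℕ → Ω → ℕ)
    (G : ℕ → EuclideanSpace ℝ (Fin d) → Ω → EuclideanSpace ℝ (Fin d)) :
    ℕ → MeasurableSpace Ω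
  | 0 => MeasurableSpace.comap X₁ inferInstance
  | n + 1 => MeasurableSpace.comap (U (n + 1)) inferInstance ⊔
      ⨆ v ∈ (Vodd ∪ Vev : Set (EuclideanSpace ℝ (Fin d))),
        MeasurableSpace.comap (G (n + 2) v) inferInstance

/-- The random inputs of the elephant random walk with parameters `p`, `q`: the first step `X₁`,
the uniformly chosen past times `U n` (`n ≥ 1`), and the random maps `G k` (`k ≥ 2`) that turn a
remembered step into the `k`-th step. The joint law of `(G k v)`, `v ∈ Vodd ∪ Vev`, is not
prescribed, only its marginals are. -/
structure IsInput {d : ℕ} {Ω : Type*} [MeasurableSpace Ω] (μ : Measure Ω)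
    (Vodd Vev : Finset (EuclideanSpace ℝ (Fin d))) (p q : ℝ)
    (X₁ : Ω → EuclideanSpace ℝ (Fin d)) (U : ℕ → Ω → ℕ)
    (G : ℕ → EuclideanSpace ℝ (Fin d) → Ω → EuclideanSpace ℝ (Fin d)) : Prop where
  first_measurable : Measurable X₁
  first_mem : ∀ ω, X₁ ω ∈ Vodd
  first_law : ∀ v ∈ Vodd, μ.real {ω | X₁ ω = v} = 1 / (Vodd.card : ℝ)
  time_measurable : ∀ n, 1 ≤ n → Measurable (U n)
  time_mem : ∀ n, 1 ≤ n → ∀ ω, U n ω ∈ Finset.Icc 1 n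
  time_law : ∀ n, 1 ≤ n → ∀ j ∈ Finset.Icc 1 n, μ.real {ω | U n ω = j} = 1 / (n : ℝ)
  map_measurable : ∀ k, 2 ≤ k → ∀ v ∈ (Vodd ∪ Vev : Set (EuclideanSpace ℝ (Fin d))),
    Measurable (G k v)
  map_mem : ∀ k, 2 ≤ k → ∀ v ∈ (Vodd ∪ Vev : Set (EuclideanSpace ℝ (Fin d))),
    ∀ ω, G k v ω ∈ stepSet Vodd Vev k
  map_law : ∀ k, 2 ≤ k → ∀ v ∈ (Vodd ∪ Vev : Set (EuclideanSpace ℝ (Fin d))),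
    ∀ w ∈ stepSet Vodd Vev k,
      μ.real {ω | G k v ω = w} = jumpProb p q (stepSet Vodd Vev k) v w
  indep_innovation : iIndep (innovation Vodd Vev X₁ U G) μ
  indep_time_map : ∀ n, 1 ≤ n →
    Indep (MeasurableSpace.comap (U n) inferInstance)
      (⨆ v ∈ (Vodd ∪ Vev : Set (EuclideanSpace ℝ (Fin d))),
        MeasurableSpace.comap (G (n + 1) v) inferInstance) μ

/-- The steps `X n`, `n ≥ 1`: the first one is `X₁`, and `X (n + 1) = G (n + 1) (X (U n))` for
`n ≥ 1`, see `step_succ`. The minimum with `n + 1` is inactive because `U (n + 1) ≤ n + 1`; it only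
makes the recursion well founded. The value at `0` is never used. -/
def step {d : ℕ} {Ω : Type*} (X₁ : Ω → EuclideanSpace ℝ (Fin d)) (U : ℕ → Ω → ℕ)
    (G : ℕ → EuclideanSpace ℝ (Fin d) → Ω → EuclideanSpace ℝ (Fin d)) (n : ℕ) (ω : Ω) :
    EuclideanSpace ℝ (Fin d) :=
  match n with
  | 0 => 0
  | 1 => X₁ ω
  | n + 2 => G (n + 2) (step X₁ U G (min (U (n + 1) ω) (n + 1)) ω) ω
termination_by n
decreasing_by omega

theorem step_one {d : ℕ} {Ω : Type*} (X₁ : Ω → EuclideanSpace ℝ (Fin d)) (U : ℕ → Ω → ℕ)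
    (G : ℕ → EuclideanSpace ℝ (Fin d) → Ω → EuclideanSpace ℝ (Fin d)) (ω : Ω) :
    step X₁ U G 1 ω = X₁ ω := by
  rw [step]

theorem step_succ {d : ℕ} {Ω : Type*} (X₁ : Ω → EuclideanSpace ℝ (Fin d)) (U : ℕ → Ω → ℕ)
    (G : ℕ → EuclideanSpace ℝ (Fin d) → Ω → EuclideanSpace ℝ (Fin d)) (n : ℕ) (hn : 1 ≤ n)
    (ω : Ω) (hU : U n ω ≤ n) :
    step X₁ U G (n + 1) ω = G (n + 1) (step X₁ U G (U n ω) ω) ω := by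
  obtain ⟨k, rfl⟩ : ∃ k, n = k + 1 := ⟨n - 1, by omega⟩
  rw [step, min_eq_left hU]

/-- The position `S n = X 1 + ⋯ + X n` of the elephant random walk, with `S 0 = 0`. -/
def position {d : ℕ} {Ω : Type*} (X₁ : Ω → EuclideanSpace ℝ (Fin d)) (U : ℕ → Ω → ℕ)
    (G : ℕ → EuclideanSpace ℝ (Fin d) → Ω → EuclideanSpace ℝ (Fin d)) (n : ℕ) (ω : Ω) :
    EuclideanSpace ℝ (Fin d) :=
  ∑ k ∈ Finset.range n, step X₁ U G (k + 1) ω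

/-- `α` as a function of `m` and `p`, and also `β` as a function of `m` and `q`. -/
def memoryCoeff (m : ℕ) (r : ℝ) : ℝ := ((m : ℝ) * r - 1) / ((m : ℝ) - 1)

/-- The parameter `δ = (α - β) / 2`. -/
def delta (m : ℕ) (p q : ℝ) : ℝ := (memoryCoeff m p - memoryCoeff m q) / 2

/-- The mean `v̄` of the odd steps. -/
def meanStep {d : ℕ} (Vodd : Finset (EuclideanSpace ℝ (Fin d))) : EuclideanSpace ℝ (Fin d) :=
  (1 / (Vodd.card : ℝ)) • ∑ v ∈ Vodd, v

/-- The matrix `(1 / m) ∑ (v - v̄) (v - v̄)ᵀ`, the sum being over the odd steps `v`. -/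
def limitCov {d : ℕ} (Vodd : Finset (EuclideanSpace ℝ (Fin d))) : Matrix (Fin d) (Fin d) ℝ :=
  (1 / (Vodd.card : ℝ)) •
    ∑ v ∈ Vodd, Matrix.vecMulVec (v - meanStep Vodd).ofLp (v - meanStep Vodd).ofLp

end

end ERW

/-! Multiplying the `k`-th step by `(-1)^(k-1)` makes every step odd. For `h` with zero sum over
`Vodd`, let `x k` be `h` at the signed steps, `A n` their partial sums and `B n` their alternating
sums. The uniform part of the jump law annihilates `h`, so the conditional mean of `x n` is `(γ * A
n + (-1)^n * δ * B n) / n`: same-parity memories carry `α = γ + δ`, opposite-parity ones `β = γ -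
δ`. With `h v = ⟪v - v̄, t⟫`, the projection `⟪S n, t⟫` is `B n` up to a bounded error.

For `δ = 1/2`, `B (n+1) = (1 + 1/(2n)) * B n + γ * (-1)^n * A n / n + noise`, and the growth factor
matches `√(n+1) / √n` up to `O(n⁻²)`. The `A` term alternates in sign with a slowly varying
coefficient, so summation by parts bounds its total contribution whatever the size of `A n`; this is
why `γ` needs no condition. Hence `B n / √n = M n + O(1)` pointwise
(`exists_abs_altSum_div_sqrt_sub_noiseSum_le`), where `M n = ∑ noise k / √(k+1)` is a martingale and
the harmonic weights give the scale `log n`.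

The conditional variance of the noise tends in `L¹` to `s`, the mean of `h²` over `Vodd`. Indeed
`E[B n²] = O(n log n)` and `E[A n²] = o(n²)`, so the drift tends to zero in `L²`; and `h² - s` also
has zero sum, so the same argument applies to `x² - s`. A telescoping comparison of characteristic
functions (`tendsto_integral_exp_noiseSum`) turns this into the limit for `M n / √(log n)`, and
Lévy's continuity theorem concludes. -/

namespace ERW

noncomputable section

/-! ### Real sequences: partial sums, alternating sums, drift and noise -/

/-- The alternating sum `x 0 - x 1 + ⋯` of the first `n` terms. -/
def altSum (x : ℕ → ℝ) (n : ℕ) : ℝ := ∑ k ∈ Finset.range n, (-1) ^ k * x k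

/-- The conditional mean of `x n` given `x 0, …, x (n - 1)`. -/
def drift (γ : ℝ) (x : ℕ → ℝ) (n : ℕ) : ℝ :=
  (γ * ∑ k ∈ Finset.range n, x k + (-1) ^ n * altSum x n / 2) / n

/-- The signed innovation of the `n`-th term. -/
def noise (γ : ℝ) (x : ℕ → ℝ) (n : ℕ) : ℝ := (-1) ^ n * (x n - drift γ x n)

/-- The martingale approximating `altSum x n / √n`. -/
def noiseSum (γ : ℝ) (x : ℕ → ℝ) (n : ℕ) : ℝ :=
  ∑ k ∈ Finset.range n, noise γ x k / √((k : ℝ) + 1)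

theorem abs_sum_range_le {x : ℕ → ℝ} {C : ℝ} (hx : ∀ k, |x k| ≤ C) (n : ℕ) :
    |∑ k ∈ Finset.range n, x k| ≤ C * n := by
  calc _ ≤ ∑ k ∈ Finset.range n, |x k| := Finset.abs_sum_le_sum_abs _ _
    _ ≤ ∑ k ∈ Finset.range n, C := Finset.sum_le_sum fun k _ => hx k
    _ = _ := by simp [mul_comm]

theorem abs_altSum_le {x : ℕ → ℝ} {C : ℝ} (hx : ∀ k, |x k| ≤ C) (n : ℕ) :
    |altSum x n| ≤ C * n :=
  abs_sum_range_le (x := fun k => (-1) ^ k * x k) (fun k => by simpa [abs_mul] using hx k) n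

/-- The two averages in the drift carry weights `|γ|` and `1/2`, of total at most `1`. -/
theorem abs_drift_le {x : ℕ → ℝ} {C γ : ℝ} (hγ : |γ| ≤ 1 / 2) (hx : ∀ k, |x k| ≤ C) (n : ℕ) :
    |drift γ x n| ≤ C := by
  have hC : 0 ≤ C := (abs_nonneg _).trans (hx 0)
  have h1 := abs_sum_range_le hx n
  have h2 := abs_altSum_le hx n
  have hn : (0 : ℝ) ≤ n := n.cast_nonneg
  unfold drift
  rw [abs_div, Nat.abs_cast]
  refine div_le_of_le_mul₀ hn hC ?_
  refine (abs_add_le _ _).trans ?_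
  rw [abs_mul, abs_div, abs_mul, abs_pow, abs_neg, abs_one, one_pow, one_mul,
    abs_of_pos (by norm_num : (0 : ℝ) < 2)]
  have := mul_le_mul hγ h1 (abs_nonneg _) (by norm_num)
  linarith

theorem abs_noise_le {x : ℕ → ℝ} {C γ : ℝ} (hγ : |γ| ≤ 1 / 2) (hx : ∀ k, |x k| ≤ C) (n : ℕ) :
    |noise γ x n| ≤ 2 * C := by
  unfold noise
  rw [abs_mul, abs_pow, abs_neg, abs_one, one_pow, one_mul]
  have := abs_sub (x n) (drift γ x n)
  linarith [hx n, abs_drift_le hγ hx n]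

/-- The three terms are the martingale increment, an alternating perturbation, and the mismatch
between `1 + 1/(2n)` and `√(n+1) / √n`. -/
theorem altSum_div_sqrt_succ_sub (γ : ℝ) (x : ℕ → ℝ) {n : ℕ} (hn : 1 ≤ n) :
    altSum x (n + 1) / √((n : ℝ) + 1) - altSum x n / √n =
      noise γ x n / √((n : ℝ) + 1) +
        γ * (-1) ^ n * ((∑ k ∈ Finset.range n, x k) / (n * √((n : ℝ) + 1))) +
        altSum x n * ((1 + 1 / (2 * n)) / √((n : ℝ) + 1) - 1 / √n) := by
  have h0 : (n : ℝ) ≠ 0 := by positivity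
  have h1 : √((n : ℝ) + 1) ≠ 0 := by positivity
  have h2 : √(n : ℝ) ≠ 0 := by positivity
  have h3 : ((-1 : ℝ) ^ n) * (-1) ^ n = 1 := by rw [← mul_pow]; simp
  have : altSum x (n + 1) = altSum x n + (-1) ^ n * x n := by
    simp [altSum, Finset.sum_range_succ]
  rw [this]
  unfold noise drift
  generalize altSum x n = B
  generalize ∑ k ∈ Finset.range n, x k = A
  generalize (-1 : ℝ) ^ n = e at *
  field_simp
  linear_combination (√(n : ℝ) * B) * h3

theorem abs_one_add_half_div_sqrt_sub_le {n : ℕ} (hn : 1 ≤ n) :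
    |(1 + 1 / (2 * (n : ℝ))) / √((n : ℝ) + 1) - 1 / √n| ≤ 1 / (n * (n * √n)) := by
  have h0 : (0 : ℝ) < n := by positivity
  have hs : 0 < √(n : ℝ) := by positivity
  have ht : 0 < √((n : ℝ) + 1) := by positivity
  have hs2 : √(n : ℝ) ^ 2 = n := Real.sq_sqrt h0.le
  have ht2 : √((n : ℝ) + 1) ^ 2 = n + 1 := Real.sq_sqrt (by positivity)
  have hst : √(n : ℝ) ≤ √((n : ℝ) + 1) := Real.sqrt_le_sqrt (by linarith)
  set s := √(n : ℝ)
  set t := √((n : ℝ) + 1)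
  -- The numerator `s² + 1/2 - s t` is rationalised: `(s² + 1/2)² - s² t² = 1/4`, because `t² = s² +
  -- 1`.
  have key : (1 + 1 / (2 * (n : ℝ))) / t - 1 / s =
      1 / (4 * (s ^ 2 * t) * (s ^ 2 + 1 / 2 + s * t)) := by
    rw [← hs2]
    have ht3 : t ^ 2 = s ^ 2 + 1 := by rw [ht2, hs2]
    field_simp
    linear_combination (-16 * s ^ 2) * ht3
  rw [key, abs_of_pos (by positivity), ← hs2]
  apply one_div_le_one_div_of_le (by positivity)
  nlinarith [mul_le_mul_of_nonneg_left hst (by positivity : 0 ≤ s ^ 4),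
    (by positivity : 0 < s ^ 2 * t * (1 / 2 + s * t))]

theorem one_div_mul_sqrt_sub_le {n : ℕ} (hn : 1 ≤ n) :
    |1 / (((n : ℝ) + 1) * √((n : ℝ) + 1 + 1)) - 1 / ((n : ℝ) * √((n : ℝ) + 1))| ≤
      2 / (n * (n * √n)) := by
  have h0 : (0 : ℝ) < n := by positivity
  have hr : 0 < √(n : ℝ) := by positivity
  have hs : 0 < √((n : ℝ) + 1) := by positivity
  have ht : 0 < √((n : ℝ) + 1 + 1) := by positivity
  have hs2 : √((n : ℝ) + 1) ^ 2 = n + 1 := Real.sq_sqrt (by positivity)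
  have ht2 : √((n : ℝ) + 1 + 1) ^ 2 = n + 1 + 1 := Real.sq_sqrt (by positivity)
  have hrs : √(n : ℝ) ≤ √((n : ℝ) + 1) := Real.sqrt_le_sqrt (by linarith)
  have hst : √((n : ℝ) + 1) ≤ √((n : ℝ) + 1 + 1) := Real.sqrt_le_sqrt (by linarith)
  set r := √(n : ℝ)
  set s := √((n : ℝ) + 1)
  set t := √((n : ℝ) + 1 + 1)
  have hle : 1 / (((n : ℝ) + 1) * t) ≤ 1 / ((n : ℝ) * s) :=
    one_div_le_one_div_of_le (by positivity) (by nlinarith)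
  rw [abs_sub_comm, abs_of_nonneg (by linarith)]
  have hnum : ((n : ℝ) + 1) * t - n * s ≤ 2 * s := by nlinarith
  calc 1 / ((n : ℝ) * s) - 1 / (((n : ℝ) + 1) * t)
      = (((n : ℝ) + 1) * t - n * s) / (n * s * ((n + 1) * t)) := by field_simp
    _ ≤ 2 * s / (n * s * ((n + 1) * t)) := by gcongr
    _ = 2 / (n * ((n + 1) * t)) := by field_simp
    _ ≤ _ := by
      gcongr
      · linarith
      · exact hrs.trans hst

/-- A deterministic estimate, with `K` uniform over all sequences bounded by `C`. The mismatch terms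
are `O(n^(-3/2))`, hence summable, and the alternating terms are summed by parts. -/
theorem exists_abs_altSum_div_sqrt_sub_noiseSum_le {γ : ℝ} (hγ : |γ| ≤ 1 / 2) {C : ℝ}
    (hC : 0 ≤ C) :
    ∃ K, ∀ x : ℕ → ℝ, (∀ k, |x k| ≤ C) → ∀ n, |altSum x n / √n - noiseSum γ x n| ≤ K := by
  set u : ℕ → ℝ := fun n => 1 / (n * √n) with hu
  have hsum : Summable u := by
    have := Real.summable_one_div_nat_rpow.2 (by norm_num : (1 : ℝ) < 3 / 2)
    refine this.congr fun n => ?_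
    rcases Nat.eq_zero_or_pos n with rfl | hn
    · simp [hu]
    · have h0 : (0 : ℝ) < n := by positivity
      rw [hu]; dsimp only
      rw [Real.sqrt_eq_rpow, show (3 / 2 : ℝ) = 1 + 1 / 2 by norm_num, Real.rpow_add h0,
        Real.rpow_one]
  have hu0 : ∀ n, 0 ≤ u n := fun n => by positivity
  refine ⟨6 * C + 3 * C * ∑' n, u n, fun x hx => ?_⟩
  set c : ℕ → ℝ := fun n => (∑ k ∈ Finset.range n, x k) / (n * √((n : ℝ) + 1)) with hc
  set R : ℕ → ℝ := fun n => altSum x n / √n - noiseSum γ x n with hR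
  have hcb : ∀ n, |c n| ≤ C := fun n => by
    rw [hc]; dsimp only
    rw [abs_div, abs_of_nonneg (by positivity : 0 ≤ (n : ℝ) * √((n : ℝ) + 1))]
    refine div_le_of_le_mul₀ (by positivity) hC ((abs_sum_range_le hx n).trans ?_)
    have : 1 ≤ √((n : ℝ) + 1) := Real.one_le_sqrt.2 (by linarith [n.cast_nonneg (α := ℝ)])
    exact mul_le_mul_of_nonneg_left (le_mul_of_one_le_right n.cast_nonneg this) hC
  have hcd : ∀ n, 1 ≤ n → |c n - c (n + 1)| ≤ 3 * C * u n := fun n hn => by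
    have h0 : (0 : ℝ) < n := by positivity
    have e : c n - c (n + 1) = -(x n / (((n : ℝ) + 1) * √((n : ℝ) + 1 + 1))) -
        (∑ k ∈ Finset.range n, x k) * (1 / (((n : ℝ) + 1) * √((n : ℝ) + 1 + 1)) -
          1 / ((n : ℝ) * √((n : ℝ) + 1))) := by
      simp only [hc, Finset.sum_range_succ]; push_cast; ring
    rw [e]
    refine (abs_sub _ _).trans ?_
    rw [abs_neg, abs_mul, abs_div,
      abs_of_pos (by positivity : 0 < ((n : ℝ) + 1) * √((n : ℝ) + 1 + 1))]
    have h1 : |x n| / (((n : ℝ) + 1) * √((n : ℝ) + 1 + 1)) ≤ C / (n * √n) := by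
      gcongr
      · exact hx n
      · linarith
      · linarith
    have h2 := mul_le_mul (abs_sum_range_le hx n) (one_div_mul_sqrt_sub_le hn) (abs_nonneg _)
      (by positivity)
    have h3 : C * n * (2 / (n * (n * √(n : ℝ)))) = 2 * C / (n * √n) := by field_simp
    have h4 : 3 * C * u n = C / (n * √n) + 2 * C / (n * √n) := by rw [hu]; ring
    linarith
  -- Summation by parts in additive form: `R` changes by `γ (-1)^n c n` up to a summable error, and
  -- adding half the alternating term leaves only the difference `c n - c (n+1)`.
  have hstep : ∀ n, 1 ≤ n → |(R (n + 1) + γ * (-1) ^ (n + 1) * c (n + 1) / 2) -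
      (R n + γ * (-1) ^ n * c n / 2)| ≤ 3 * C * u n := fun n hn => by
    have h0 : (0 : ℝ) < n := by positivity
    have e : (R (n + 1) + γ * (-1) ^ (n + 1) * c (n + 1) / 2) -
        (R n + γ * (-1) ^ n * c n / 2) = γ * (-1) ^ n * (c n - c (n + 1)) / 2 +
          altSum x n * ((1 + 1 / (2 * n)) / √((n : ℝ) + 1) - 1 / √n) := by
      have := altSum_div_sqrt_succ_sub γ x hn
      have h2 : noiseSum γ x (n + 1) = noiseSum γ x n + noise γ x n / √((n : ℝ) + 1) := by
        simp [noiseSum, Finset.sum_range_succ]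
      have h3 : R (n + 1) = altSum x (n + 1) / √((n : ℝ) + 1) - noiseSum γ x (n + 1) := by
        simp [hR]
      rw [h3, h2]
      simp only [hR]
      rw [pow_succ]
      linear_combination this
    rw [e]
    refine (abs_add_le _ _).trans ?_
    rw [abs_div, abs_mul, abs_mul, abs_pow, abs_neg, abs_one, one_pow, mul_one, abs_mul,
      abs_of_pos (by norm_num : (0 : ℝ) < 2)]
    have h1 := mul_le_mul hγ (hcd n hn) (abs_nonneg _) (by norm_num)
    have h2 := mul_le_mul (abs_altSum_le hx n) (abs_one_add_half_div_sqrt_sub_le hn)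
      (abs_nonneg _) (by positivity)
    have h3 : C * n * (1 / (n * (n * √(n : ℝ)))) = C * u n := by rw [hu]; field_simp
    have := mul_nonneg hC (hu0 n)
    linarith
  have hb : ∀ n, |γ * (-1) ^ n * c n / 2| ≤ C := fun n => by
    rw [abs_div, abs_mul, abs_mul, abs_pow, abs_neg, abs_one, one_pow, mul_one,
      abs_of_pos (by norm_num : (0 : ℝ) < 2)]
    have := mul_le_mul hγ (hcb n) (abs_nonneg _) (by norm_num)
    linarith
  have hR1 : |R 1| ≤ 3 * C := by
    have h1 := abs_noise_le hγ hx 0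
    have h2 : R 1 = x 0 - noise γ x 0 := by simp [hR, altSum, noiseSum]
    rw [h2]
    linarith [abs_sub (x 0) (noise γ x 0), hx 0]
  have hind : ∀ n, 1 ≤ n → |R n + γ * (-1) ^ n * c n / 2| ≤
      4 * C + 3 * C * ∑ k ∈ Finset.range n, u k := by
    intro n hn
    induction n, hn using Nat.le_induction with
    | base =>
      have h1 := abs_add_le (R 1) (γ * (-1) ^ 1 * c 1 / 2)
      have h2 := hb 1
      have h3 : 0 ≤ 3 * C * ∑ k ∈ Finset.range 1, u k := by
        have := Finset.sum_nonneg (s := Finset.range 1) fun k _ => hu0 k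
        positivity
      linarith
    | succ n hn ih =>
      rw [Finset.sum_range_succ, mul_add]
      have h1 := hstep n hn
      have h2 := abs_add_le (R n + γ * (-1) ^ n * c n / 2)
        ((R (n + 1) + γ * (-1) ^ (n + 1) * c (n + 1) / 2) - (R n + γ * (-1) ^ n * c n / 2))
      rw [add_sub_cancel] at h2
      linarith
  intro n
  have ht : ∑ k ∈ Finset.range n, u k ≤ ∑' n, u n := hsum.sum_le_tsum _ fun k _ => hu0 k
  have ht0 : 0 ≤ ∑' n, u n := tsum_nonneg hu0
  rcases Nat.eq_zero_or_pos n with rfl | hn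
  · simp [altSum, noiseSum]; positivity
  · have h1 := hind n hn
    have h2 := hb n
    have h3 := abs_sub (R n + γ * (-1) ^ n * c n / 2) (γ * (-1) ^ n * c n / 2)
    rw [add_sub_cancel_right] at h3
    have := mul_le_mul_of_nonneg_left ht (by positivity : 0 ≤ 3 * C)
    change |R n| ≤ _
    linarith

/-! ### Harmonic averages -/

theorem sum_range_one_div_le {n : ℕ} :
    ∑ k ∈ Finset.range n, 1 / ((k : ℝ) + 1) ≤ 1 + Real.log n := by
  have := harmonic_le_one_add_log n
  simpa [harmonic] using this

theorem log_le_sum_range_one_div {n : ℕ} :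
    Real.log ((n : ℝ) + 1) ≤ ∑ k ∈ Finset.range n, 1 / ((k : ℝ) + 1) := by
  have := log_add_one_le_harmonic n
  simpa [harmonic] using this

theorem tendsto_log_natCast : Tendsto (fun n : ℕ => Real.log n) atTop atTop :=
  Real.tendsto_log_atTop.comp tendsto_natCast_atTop_atTop

theorem tendsto_harmonic_div_log :
    Tendsto (fun n : ℕ => (∑ k ∈ Finset.range n, 1 / ((k : ℝ) + 1)) / Real.log n) atTop
      (𝓝 1) := by
  have h1 : Tendsto (fun n : ℕ => 1 + 1 / Real.log n) atTop (𝓝 1) := by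
    simpa using tendsto_const_nhds (x := (1 : ℝ)).add (tendsto_inv_atTop_zero.comp tendsto_log_natCast)
  refine tendsto_of_tendsto_of_tendsto_of_le_of_le' tendsto_const_nhds h1 ?_ ?_
  · filter_upwards [tendsto_log_natCast.eventually_gt_atTop 0, eventually_gt_atTop 0] with n hn h0
    rw [le_div_iff₀ hn, one_mul]
    refine le_trans (Real.log_le_log (by positivity) (by linarith)) log_le_sum_range_one_div
  · filter_upwards [tendsto_log_natCast.eventually_gt_atTop 0] with n hn
    rw [div_le_iff₀ hn, add_mul, one_div, inv_mul_cancel₀ hn.ne']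
    linarith [sum_range_one_div_le (n := n)]

/-- Logarithmic Cesàro averaging: the weights `1/(k+1)` have a divergent sum, equivalent to `log n`.
-/
theorem tendsto_sum_div_log_of_tendsto_zero {e : ℕ → ℝ} (he : Tendsto e atTop (𝓝 0)) :
    Tendsto (fun n : ℕ => (∑ k ∈ Finset.range n, 1 / ((k : ℝ) + 1) * e k) / Real.log n) atTop
      (𝓝 0) := by
  have hdiv : Tendsto (fun n : ℕ => ∑ k ∈ Finset.range n, 1 / ((k : ℝ) + 1)) atTop atTop := by
    refine tendsto_atTop_mono (fun n => log_le_sum_range_one_div) ?_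
    exact Real.tendsto_log_atTop.comp (tendsto_atTop_add_const_right _ _ tendsto_natCast_atTop_atTop)
  have ho : (fun k : ℕ => 1 / ((k : ℝ) + 1) * e k) =o[atTop] fun k : ℕ => 1 / ((k : ℝ) + 1) := by
    simpa using (Asymptotics.isBigO_refl (fun k : ℕ => 1 / ((k : ℝ) + 1)) atTop).mul_isLittleO
      ((Asymptotics.isLittleO_one_iff ℝ).2 he)
  have h := (ho.sum_range (fun k => by dsimp; positivity) hdiv).tendsto_div_nhds_zero
  have h2 := h.mul tendsto_harmonic_div_log
  rw [zero_mul] at h2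
  refine h2.congr' ?_
  filter_upwards [hdiv.eventually_gt_atTop 0] with n hn
  field_simp


/-! ### Bounded processes whose conditional mean is the drift -/

section Memory

variable {Ω : Type*} {mΩ : MeasurableSpace Ω}

theorem measurable_sum_range {m : MeasurableSpace Ω} {x : ℕ → Ω → ℝ} {n : ℕ}
    (hx : ∀ k < n, Measurable[m] (x k)) :
    Measurable[m] fun ω => ∑ k ∈ Finset.range n, x k ω :=
  Finset.measurable_fun_sum _ fun k hk => hx k (Finset.mem_range.1 hk)

theorem measurable_altSum {m : MeasurableSpace Ω} {x : ℕ → Ω → ℝ} {n : ℕ}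
    (hx : ∀ k < n, Measurable[m] (x k)) :
    Measurable[m] fun ω => altSum (fun k => x k ω) n :=
  measurable_sum_range (x := fun k ω => (-1) ^ k * x k ω) fun k hk => (hx k hk).const_mul _

theorem measurable_drift {m : MeasurableSpace Ω} {x : ℕ → Ω → ℝ} {n : ℕ} (γ : ℝ)
    (hx : ∀ k < n, Measurable[m] (x k)) :
    Measurable[m] fun ω => drift γ (fun k => x k ω) n :=
  (((measurable_sum_range hx).const_mul γ).add
    (((measurable_altSum hx).const_mul ((-1) ^ n)).div_const 2)).div_const (n : ℝ)

theorem measurable_noise {m : MeasurableSpace Ω} {x : ℕ → Ω → ℝ} {n : ℕ} (γ : ℝ)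
    (hx : ∀ k < n + 1, Measurable[m] (x k)) :
    Measurable[m] fun ω => noise γ (fun k => x k ω) n :=
  ((hx n n.lt_succ_self).sub
    (measurable_drift γ fun k hk => hx k (hk.trans n.lt_succ_self))).const_mul _

theorem measurable_noiseSum {m : MeasurableSpace Ω} {x : ℕ → Ω → ℝ} {n : ℕ} (γ : ℝ)
    (hx : ∀ k < n, Measurable[m] (x k)) :
    Measurable[m] fun ω => noiseSum γ (fun k => x k ω) n :=
  measurable_sum_range (x := fun k ω => noise γ (fun k => x k ω) k / √((k : ℝ) + 1))
    fun k hk => (measurable_noise γ fun j hj => hx j (by omega)).div_const _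

theorem integrable_of_forall_norm_le {E : Type*} [NormedAddCommGroup E] [MeasurableSpace E]
    [BorelSpace E] [SecondCountableTopology E] {μ : Measure Ω} [IsFiniteMeasure μ] {f : Ω → E}
    (hf : Measurable f) {K : ℝ} (hK : ∀ ω, ‖f ω‖ ≤ K) : Integrable f μ :=
  Integrable.of_bound hf.aestronglyMeasurable K (ae_of_all _ hK)

theorem sq_integral_abs_le {μ : Measure Ω} [IsProbabilityMeasure μ] {f : Ω → ℝ}
    (hf : Measurable f) {K : ℝ} (hK : ∀ ω, |f ω| ≤ K) :
    (∫ ω, |f ω| ∂μ) ^ 2 ≤ ∫ ω, f ω ^ 2 ∂μ := by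
  have h1 : Integrable (fun ω => |f ω|) μ :=
    integrable_of_forall_norm_le (measurable_abs.comp hf) (K := K) (by simpa using hK)
  have h2 : Integrable (fun ω => f ω ^ 2) μ :=
    integrable_of_forall_norm_le (hf.pow_const 2) (K := K ^ 2) fun ω => by
      rw [norm_pow]; exact pow_le_pow_left₀ (norm_nonneg _) (hK ω) 2
  set a := ∫ ω, |f ω| ∂μ
  have h3 : 0 ≤ ∫ ω, (f ω ^ 2 - 2 * a * |f ω| + a ^ 2) ∂μ :=
    integral_nonneg fun ω => by
      have := sq_nonneg (|f ω| - a)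
      have h := sq_abs (f ω)
      change 0 ≤ f ω ^ 2 - 2 * a * |f ω| + a ^ 2
      nlinarith
  have h4 : Integrable (fun ω => f ω ^ 2 - 2 * a * |f ω|) μ := h2.sub (h1.const_mul _)
  rw [integral_add h4 (integrable_const _), integral_sub h2 (h1.const_mul _),
    integral_const_mul] at h3
  simp only [integral_const, probReal_univ, one_smul] at h3
  change 0 ≤ _ - 2 * a * a + _ at h3
  linarith

/-- A bounded process adapted to `F` (shifted by one) whose `n`-th term has the conditional mean
`drift γ x n` given `F n`. -/
structure IsMemoryProcess (μ : Measure Ω) (F : Filtration ℕ mΩ) (γ C : ℝ) (x : ℕ → Ω → ℝ) :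
    Prop where
  adapted : ∀ n, Measurable[F (n + 1)] (x n)
  bounded : ∀ n ω, |x n ω| ≤ C
  integral_mul : ∀ (n : ℕ) (Z : Ω → ℂ), Measurable[F n] Z → (∃ K, ∀ ω, ‖Z ω‖ ≤ K) →
    ∫ ω, Z ω * (x n ω : ℂ) ∂μ = ∫ ω, Z ω * (drift γ (fun k => x k ω) n : ℂ) ∂μ

namespace IsMemoryProcess

variable {μ : Measure Ω} {F : Filtration ℕ mΩ} {γ C : ℝ} {x : ℕ → Ω → ℝ}

theorem measurable_of_lt (h : IsMemoryProcess μ F γ C x) {n : ℕ} :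
    ∀ k < n, Measurable[F n] (x k) := fun k hk =>
  (h.adapted k).mono (F.mono hk) le_rfl

theorem measurable (h : IsMemoryProcess μ F γ C x) (k : ℕ) : Measurable (x k) :=
  (h.adapted k).mono (F.le _) le_rfl

theorem integral_mul_real (h : IsMemoryProcess μ F γ C x) (n : ℕ)
    {Z : Ω → ℝ} (hZ : Measurable[F n] Z) {K : ℝ} (hK : ∀ ω, |Z ω| ≤ K) :
    ∫ ω, Z ω * x n ω ∂μ = ∫ ω, Z ω * drift γ (fun k => x k ω) n ∂μ := by
  have := h.integral_mul n (fun ω => (Z ω : ℂ))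
    (Complex.measurable_ofReal.comp hZ) ⟨K, by simpa using hK⟩
  simp_rw [← Complex.ofReal_mul] at this
  rw [integral_complex_ofReal, integral_complex_ofReal] at this
  exact_mod_cast this

variable [IsProbabilityMeasure μ]

/-- The test variable `Z` is complex so that it can be an imaginary exponential of the past noise.
-/
theorem integral_mul_sub_drift (h : IsMemoryProcess μ F γ C x) (hγ : |γ| ≤ 1 / 2) (n : ℕ)
    {Z : Ω → ℂ} (hZ : Measurable[F n] Z) {K : ℝ} (hK : ∀ ω, ‖Z ω‖ ≤ K) :
    ∫ ω, Z ω * ((x n ω - drift γ (fun k => x k ω) n : ℝ) : ℂ) ∂μ = 0 := by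
  have hZ' : Measurable Z := hZ.mono (F.le n) le_rfl
  have hb : ∀ {f : Ω → ℝ}, Measurable f → (∀ ω, |f ω| ≤ C) →
      Integrable (fun ω => Z ω * (f ω : ℂ)) μ := fun {f} hf hC =>
    integrable_of_forall_norm_le (hZ'.mul (Complex.measurable_ofReal.comp hf)) (K := K * C)
      fun ω => by
        rw [norm_mul, Complex.norm_real]
        exact mul_le_mul (hK ω) (hC ω) (norm_nonneg _) ((norm_nonneg _).trans (hK ω))
  simp_rw [Complex.ofReal_sub, mul_sub]
  rw [integral_sub (hb (h.measurable n) (h.bounded n))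
    (hb (measurable_drift γ fun k _ => h.measurable k)
      fun ω => abs_drift_le hγ (fun k => h.bounded k ω) n),
    h.integral_mul n Z hZ ⟨K, hK⟩, sub_self]

theorem integral_mul_noise (h : IsMemoryProcess μ F γ C x) (hγ : |γ| ≤ 1 / 2) (n : ℕ)
    {Z : Ω → ℂ} (hZ : Measurable[F n] Z) {K : ℝ} (hK : ∀ ω, ‖Z ω‖ ≤ K) :
    ∫ ω, Z ω * (noise γ (fun k => x k ω) n : ℂ) ∂μ = 0 := by
  have := h.integral_mul_sub_drift hγ n hZ hK
  calc _ = ∫ ω, (-1) ^ n * (Z ω * ((x n ω - drift γ (fun k => x k ω) n : ℝ) : ℂ)) ∂μ := by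
        congr 1; ext ω; simp only [noise]; push_cast; ring
    _ = 0 := by rw [integral_const_mul, this, mul_zero]

theorem integral_mul_noise_real (h : IsMemoryProcess μ F γ C x) (hγ : |γ| ≤ 1 / 2) (n : ℕ)
    {Z : Ω → ℝ} (hZ : Measurable[F n] Z) {K : ℝ} (hK : ∀ ω, |Z ω| ≤ K) :
    ∫ ω, Z ω * noise γ (fun k => x k ω) n ∂μ = 0 := by
  have := h.integral_mul_noise hγ n (Z := fun ω => (Z ω : ℂ))
    (Complex.measurable_ofReal.comp hZ) (K := K) (by simpa using hK)
  simp_rw [← Complex.ofReal_mul] at this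
  rw [integral_complex_ofReal] at this
  exact_mod_cast this

theorem abs_noiseSum_le {x : ℕ → ℝ} (hγ : |γ| ≤ 1 / 2) (hx : ∀ k, |x k| ≤ C) (n : ℕ) :
    |noiseSum γ x n| ≤ 2 * C * n :=
  abs_sum_range_le (x := fun k => noise γ x k / √((k : ℝ) + 1)) (fun k => by
    have h1 : 1 ≤ √((k : ℝ) + 1) := Real.one_le_sqrt.2 (by linarith [k.cast_nonneg (α := ℝ)])
    rw [abs_div, abs_of_nonneg (Real.sqrt_nonneg _)]
    exact (div_le_self (abs_nonneg _) h1).trans (abs_noise_le hγ hx k)) n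

theorem integrable_sq {f : Ω → ℝ} (hf : Measurable f) {K : ℝ} (hK : ∀ ω, |f ω| ≤ K) :
    Integrable (fun ω => f ω ^ 2) μ :=
  integrable_of_forall_norm_le (hf.pow_const 2) (K := K ^ 2) fun ω => by
    rw [norm_pow]; exact pow_le_pow_left₀ (norm_nonneg _) (hK ω) 2

theorem integrable_mul {f g : Ω → ℝ} (hf : Measurable f) {K : ℝ} (hK : ∀ ω, |f ω| ≤ K)
    (hg : Measurable g) {K' : ℝ} (hK' : ∀ ω, |g ω| ≤ K') :
    Integrable (fun ω => f ω * g ω) μ :=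
  integrable_of_forall_norm_le (hf.mul hg) (K := K * K') fun ω => by
    rw [norm_mul]
    exact mul_le_mul (hK ω) (hK' ω) (norm_nonneg _) ((abs_nonneg _).trans (hK ω))

theorem integral_sq_le {f : Ω → ℝ} (hf : Measurable f) {K : ℝ} (hK : ∀ ω, |f ω| ≤ K) :
    ∫ ω, f ω ^ 2 ∂μ ≤ K ^ 2 := by
  calc ∫ ω, f ω ^ 2 ∂μ ≤ ∫ _, K ^ 2 ∂μ :=
        integral_mono (integrable_sq hf hK) (integrable_const _) fun ω => by
          have := pow_le_pow_left₀ (abs_nonneg _) (hK ω) 2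
          rwa [sq_abs] at this
    _ = K ^ 2 := by simp

theorem integral_add_sq {f g : Ω → ℝ} (hf : Measurable f) {K : ℝ} (hK : ∀ ω, |f ω| ≤ K)
    (hg : Measurable g) {K' : ℝ} (hK' : ∀ ω, |g ω| ≤ K') :
    ∫ ω, (f ω + g ω) ^ 2 ∂μ =
      ∫ ω, f ω ^ 2 ∂μ + 2 * ∫ ω, f ω * g ω ∂μ + ∫ ω, g ω ^ 2 ∂μ := by
  have h1 := (integrable_mul (μ := μ) hf hK hg hK').const_mul 2
  have h2 : Integrable (fun ω => f ω ^ 2 + 2 * (f ω * g ω)) μ := (integrable_sq hf hK).add h1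
  rw [← integral_const_mul, ← integral_add (integrable_sq hf hK) h1,
    ← integral_add h2 (integrable_sq hg hK')]
  congr 1; ext ω; ring

/-- Martingale increments are orthogonal, and the `k`-th has second moment at most `(2C)² / (k+1)`.
-/
theorem integral_noiseSum_sq_le (h : IsMemoryProcess μ F γ C x) (hγ : |γ| ≤ 1 / 2) (n : ℕ) :
    ∫ ω, noiseSum γ (fun k => x k ω) n ^ 2 ∂μ ≤ (2 * C) ^ 2 * (1 + Real.log n) := by
  suffices H : ∫ ω, noiseSum γ (fun k => x k ω) n ^ 2 ∂μ ≤
      ∑ k ∈ Finset.range n, (2 * C) ^ 2 * (1 / ((k : ℝ) + 1)) by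
    rw [← Finset.mul_sum] at H
    exact H.trans (mul_le_mul_of_nonneg_left sum_range_one_div_le (sq_nonneg _))
  induction n with
  | zero => simp [noiseSum]
  | succ n ih =>
    have e : ∀ ω, noiseSum γ (fun k => x k ω) (n + 1) = noiseSum γ (fun k => x k ω) n +
        noise γ (fun k => x k ω) n / √((n : ℝ) + 1) := fun ω => by
      simp [noiseSum, Finset.sum_range_succ]
    have hs : 0 < √((n : ℝ) + 1) := by positivity
    have hM := measurable_noiseSum (n := n) γ h.measurable_of_lt
    have hMb : ∀ ω, |noiseSum γ (fun k => x k ω) n| ≤ 2 * C * n := fun ω =>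
      abs_noiseSum_le hγ (fun k => h.bounded k ω) n
    have hN : Measurable fun ω => noise γ (fun k => x k ω) n / √((n : ℝ) + 1) :=
      (measurable_noise γ fun k _ => h.measurable k).div_const _
    have hNb : ∀ ω, |noise γ (fun k => x k ω) n / √((n : ℝ) + 1)| ≤ 2 * C / √((n : ℝ) + 1) :=
      fun ω => by
        rw [abs_div, abs_of_pos hs]
        exact div_le_div_of_nonneg_right (abs_noise_le hγ (fun k => h.bounded k ω) n) hs.le
    have hMN : ∫ ω, noiseSum γ (fun k => x k ω) n *
        (noise γ (fun k => x k ω) n / √((n : ℝ) + 1)) ∂μ = 0 := by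
      simp_rw [← mul_div_assoc]
      rw [integral_div, h.integral_mul_noise_real hγ n hM hMb, zero_div]
    simp_rw [e]
    rw [integral_add_sq (hM.mono (F.le n) le_rfl) hMb hN hNb, hMN, mul_zero, add_zero,
      Finset.sum_range_succ]
    refine add_le_add ih ((integral_sq_le hN hNb).trans_eq ?_)
    rw [div_pow, Real.sq_sqrt (by positivity)]
    ring

theorem integral_altSum_sq_le (h : IsMemoryProcess μ F γ C x) (hγ : |γ| ≤ 1 / 2) :
    ∃ K, ∀ n, ∫ ω, altSum (fun k => x k ω) n ^ 2 ∂μ ≤ n * (K * (1 + Real.log n) + K) := by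
  obtain ⟨ω₀⟩ : Nonempty Ω := nonempty_of_isProbabilityMeasure μ
  obtain ⟨K, hK⟩ := exists_abs_altSum_div_sqrt_sub_noiseSum_le hγ
    ((abs_nonneg _).trans (h.bounded 0 ω₀))
  refine ⟨2 * (2 * C) ^ 2 + 2 * K ^ 2, fun n => ?_⟩
  rcases Nat.eq_zero_or_pos n with rfl | hn
  · simp [altSum]
  have h0 : (0 : ℝ) < n := by positivity
  have hlog : 0 ≤ Real.log n := Real.log_natCast_nonneg n
  have hM := measurable_noiseSum (n := n) γ fun k _ => h.measurable k
  have hMb : ∀ ω, |noiseSum γ (fun k => x k ω) n| ≤ 2 * C * n := fun ω =>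
    abs_noiseSum_le hγ (fun k => h.bounded k ω) n
  have hpt : ∀ ω, altSum (fun k => x k ω) n ^ 2 ≤
      2 * n * noiseSum γ (fun k => x k ω) n ^ 2 + 2 * n * K ^ 2 := fun ω => by
    have h1 := abs_le.1 (hK (fun k => x k ω) (fun k => h.bounded k ω) n)
    set b := altSum (fun k => x k ω) n / √n with hb
    have h2 : altSum (fun k => x k ω) n ^ 2 = n * b ^ 2 := by
      rw [hb, div_pow, Real.sq_sqrt h0.le]; field_simp
    have h3 : b ^ 2 ≤ 2 * noiseSum γ (fun k => x k ω) n ^ 2 + 2 * K ^ 2 := by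
      nlinarith [sq_nonneg (b - 2 * noiseSum γ (fun k => x k ω) n)]
    rw [h2]
    nlinarith
  have h4 : ∫ ω, altSum (fun k => x k ω) n ^ 2 ∂μ ≤
      ∫ ω, (2 * n * noiseSum γ (fun k => x k ω) n ^ 2 + 2 * n * K ^ 2) ∂μ :=
    integral_mono (integrable_sq (measurable_altSum fun k _ => h.measurable k)
      fun ω => abs_altSum_le (fun k => h.bounded k ω) n)
      (((integrable_sq hM hMb).const_mul _).add (integrable_const _)) hpt
  rw [integral_add ((integrable_sq hM hMb).const_mul _) (integrable_const _),
    integral_const_mul, integral_const, probReal_univ, one_smul] at h4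
  have h5 := h.integral_noiseSum_sq_le hγ n
  have h6 := mul_le_mul_of_nonneg_left h5 (by positivity : 0 ≤ 2 * (n : ℝ))
  have h7 : 0 ≤ n * (2 * K ^ 2 * (1 + Real.log n) + 2 * (2 * C) ^ 2) := by positivity
  nlinarith

theorem tendsto_integral_altSum_sq (h : IsMemoryProcess μ F γ C x) (hγ : |γ| ≤ 1 / 2) :
    Tendsto (fun n : ℕ => (∫ ω, altSum (fun k => x k ω) n ^ 2 ∂μ) / (n : ℝ) ^ 2) atTop
      (𝓝 0) := by
  obtain ⟨K, hK⟩ := h.integral_altSum_sq_le hγ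
  have hl : Tendsto (fun n : ℕ => Real.log n / n) atTop (𝓝 0) := by
    have := (Real.isLittleO_log_id_atTop.tendsto_div_nhds_zero).comp tendsto_natCast_atTop_atTop
    exact this
  have hi : Tendsto (fun n : ℕ => (1 : ℝ) / n) atTop (𝓝 0) := tendsto_one_div_atTop_nhds_zero_nat
  have hlim : Tendsto (fun n : ℕ => K * ((1 : ℝ) / n + Real.log n / n) + K * (1 / n)) atTop
      (𝓝 0) := by
    simpa using ((hi.add hl).const_mul K).add (hi.const_mul K)
  refine squeeze_zero' (Eventually.of_forall fun n => div_nonneg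
    (integral_nonneg fun ω => sq_nonneg _) (sq_nonneg _)) ?_ hlim
  filter_upwards [eventually_gt_atTop 0] with n hn
  have h0 : (0 : ℝ) < n := by positivity
  rw [div_le_iff₀ (by positivity)]
  refine (hK n).trans_eq ?_
  field_simp

theorem tendsto_integral_abs_altSum (h : IsMemoryProcess μ F γ C x) (hγ : |γ| ≤ 1 / 2) :
    Tendsto (fun n : ℕ => (∫ ω, |altSum (fun k => x k ω) n| ∂μ) / n) atTop (𝓝 0) := by
  have h1 := (h.tendsto_integral_altSum_sq hγ).sqrt
  rw [Real.sqrt_zero] at h1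
  refine squeeze_zero (fun n => div_nonneg (integral_nonneg fun ω => abs_nonneg _)
    n.cast_nonneg) (fun n => Real.le_sqrt_of_sq_le ?_) h1
  rw [div_pow]
  exact div_le_div_of_nonneg_right (sq_integral_abs_le
    (measurable_altSum fun k _ => h.measurable k)
    fun ω => abs_altSum_le (fun k => h.bounded k ω) n) (sq_nonneg _)

/-- In the square of the new sum, the cross term is at most `E[A²]/n + C E|B|`, since `2γ ≤ 1` and
`|A| ≤ C n`. The resulting factor `1 + 1/n` is absorbed exactly by dividing by `n + 1` instead of
`n`. -/
theorem integral_sum_sq_succ_le (h : IsMemoryProcess μ F γ C x) (hγ : |γ| ≤ 1 / 2) (n : ℕ) :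
    (∫ ω, (∑ k ∈ Finset.range (n + 1), x k ω) ^ 2 ∂μ) / ((n + 1 : ℕ) : ℝ) ≤
      (∫ ω, (∑ k ∈ Finset.range n, x k ω) ^ 2 ∂μ) / n +
        (C * ∫ ω, |altSum (fun k => x k ω) n| ∂μ + C ^ 2) / ((n : ℝ) + 1) := by
  have hA : Measurable fun ω => ∑ k ∈ Finset.range n, x k ω :=
    measurable_sum_range fun k _ => h.measurable k
  have hAb : ∀ ω, |∑ k ∈ Finset.range n, x k ω| ≤ C * n := fun ω =>
    abs_sum_range_le (fun k => h.bounded k ω) n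
  have hB : Measurable fun ω => altSum (fun k => x k ω) n :=
    measurable_altSum fun k _ => h.measurable k
  have hBb : ∀ ω, |altSum (fun k => x k ω) n| ≤ C * n := fun ω =>
    abs_altSum_le (fun k => h.bounded k ω) n
  have hBi : Integrable (fun ω => |altSum (fun k => x k ω) n|) μ :=
    integrable_of_forall_norm_le (measurable_abs.comp hB) (K := C * n) (by simpa using hBb)
  have hCx : ∫ ω, x n ω ^ 2 ∂μ ≤ C ^ 2 := integral_sq_le (h.measurable n) (h.bounded n)
  have e : ∀ ω, ∑ k ∈ Finset.range (n + 1), x k ω = ∑ k ∈ Finset.range n, x k ω + x n ω :=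
    fun ω => Finset.sum_range_succ _ _
  simp_rw [e]
  rw [integral_add_sq hA hAb (h.measurable n) (h.bounded n),
    h.integral_mul_real n (measurable_sum_range h.measurable_of_lt) hAb]
  set a := ∫ ω, (∑ k ∈ Finset.range n, x k ω) ^ 2 ∂μ with ha
  set b := ∫ ω, |altSum (fun k => x k ω) n| ∂μ with hb
  have ha0 : 0 ≤ a := integral_nonneg fun ω => sq_nonneg _
  have hb0 : 0 ≤ b := integral_nonneg fun ω => abs_nonneg _
  have hC : 0 ≤ C := by
    obtain ⟨ω₀⟩ : Nonempty Ω := nonempty_of_isProbabilityMeasure μ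
    exact (abs_nonneg _).trans (h.bounded 0 ω₀)
  have key : 2 * ∫ ω, (∑ k ∈ Finset.range n, x k ω) * drift γ (fun k => x k ω) n ∂μ ≤
      a / n + C * b := by
    rcases Nat.eq_zero_or_pos n with rfl | hn
    · simp; positivity
    have h0 : (0 : ℝ) < n := by positivity
    have hD : Measurable fun ω => drift γ (fun k => x k ω) n :=
      measurable_drift γ fun k _ => h.measurable k
    have hDb : ∀ ω, |drift γ (fun k => x k ω) n| ≤ C := fun ω =>
      abs_drift_le hγ (fun k => h.bounded k ω) n
    rw [ha, hb, ← integral_const_mul, ← integral_const_mul, ← integral_div,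
      ← integral_add ((integrable_sq hA hAb).div_const _) (hBi.const_mul _)]
    refine integral_mono ((integrable_mul hA hAb hD hDb).const_mul 2)
      (((integrable_sq hA hAb).div_const _).add (hBi.const_mul _)) fun ω => ?_
    have hAω := hAb ω
    simp only [drift]
    set A := ∑ k ∈ Finset.range n, x k ω
    set B := altSum (fun k => x k ω) n
    have h1 : A * ((-1) ^ n * B) ≤ C * n * |B| := by
      refine (le_abs_self _).trans ?_
      rw [abs_mul, abs_mul, abs_pow, abs_neg, abs_one, one_pow, one_mul]
      exact mul_le_mul_of_nonneg_right hAω (abs_nonneg _)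
    have h2 : γ * A ^ 2 ≤ 1 / 2 * A ^ 2 :=
      mul_le_mul_of_nonneg_right ((le_abs_self γ).trans hγ) (sq_nonneg _)
    have e1 : 2 * (A * ((γ * A + (-1) ^ n * B / 2) / n)) =
        (2 * (γ * A ^ 2) + A * ((-1) ^ n * B)) / n := by field_simp
    have e2 : A ^ 2 / n + C * |B| = (A ^ 2 + C * n * |B|) / n := by field_simp
    rw [e1, e2]
    exact div_le_div_of_nonneg_right (by linarith) h0.le
  have hn1 : (0 : ℝ) < (n : ℝ) + 1 := by positivity
  rw [Nat.cast_add_one, div_le_iff₀ hn1, add_mul, div_mul_cancel₀ _ hn1.ne']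
  -- At `n = 0` the quotient is `0` by convention, which is harmless because `a` is then `0`.
  have h3 : a ≤ a / n * n := by
    rcases Nat.eq_zero_or_pos n with hn | hn
    · have : a = 0 := by rw [ha]; subst hn; simp
      simp [this]
    · rw [div_mul_cancel₀]; positivity
  nlinarith

/-- Iterating the one-step inequality bounds the quotient by the Cesàro mean of `w`, which tends to
zero because `E|B n| = o(n)`. -/
theorem tendsto_integral_sum_sq (h : IsMemoryProcess μ F γ C x) (hγ : |γ| ≤ 1 / 2) :
    Tendsto (fun n : ℕ => (∫ ω, (∑ k ∈ Finset.range n, x k ω) ^ 2 ∂μ) / (n : ℝ) ^ 2) atTop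
      (𝓝 0) := by
  set w : ℕ → ℝ := fun n =>
    (C * ∫ ω, |altSum (fun k => x k ω) n| ∂μ + C ^ 2) / ((n : ℝ) + 1) with hw
  have hi : Tendsto (fun n : ℕ => (1 : ℝ) / ((n : ℝ) + 1)) atTop (𝓝 0) :=
    tendsto_one_div_add_atTop_nhds_zero_nat
  have hw0 : Tendsto w atTop (𝓝 0) := by
    have h1 := ((h.tendsto_integral_abs_altSum hγ).const_mul C).mul
      (tendsto_natCast_div_add_atTop (1 : ℝ))
    have h2 := h1.add (hi.const_mul (C ^ 2))
    simp only [mul_zero, zero_mul, add_zero] at h2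
    refine h2.congr' ?_
    filter_upwards [eventually_gt_atTop 0] with n hn
    have h0 : (0 : ℝ) < n := by positivity
    simp only [hw]
    field_simp
  have hle : ∀ n : ℕ, (∫ ω, (∑ k ∈ Finset.range n, x k ω) ^ 2 ∂μ) / (n : ℝ) ≤
      ∑ k ∈ Finset.range n, w k := fun n => by
    induction n with
    | zero => simp
    | succ n ih =>
      rw [Finset.sum_range_succ]
      have := h.integral_sum_sq_succ_le hγ n
      simp only [hw] at *
      linarith
  refine squeeze_zero (fun n => div_nonneg (integral_nonneg fun ω => sq_nonneg _)
    (sq_nonneg _)) (fun n => ?_) hw0.cesaro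
  rw [sq (n : ℝ), ← div_div, inv_mul_eq_div]
  exact div_le_div_of_nonneg_right (hle n) n.cast_nonneg

theorem tendsto_integral_drift_sq (h : IsMemoryProcess μ F γ C x) (hγ : |γ| ≤ 1 / 2) :
    Tendsto (fun n : ℕ => ∫ ω, drift γ (fun k => x k ω) n ^ 2 ∂μ) atTop (𝓝 0) := by
  have hlim := (h.tendsto_integral_sum_sq hγ).add (h.tendsto_integral_altSum_sq hγ)
  rw [add_zero] at hlim
  refine squeeze_zero (fun n => integral_nonneg fun ω => sq_nonneg _) (fun n => ?_) hlim
  have hA : Integrable (fun ω => (∑ k ∈ Finset.range n, x k ω) ^ 2) μ :=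
    integrable_sq (measurable_sum_range fun k _ => h.measurable k)
      fun ω => abs_sum_range_le (fun k => h.bounded k ω) n
  have hB : Integrable (fun ω => altSum (fun k => x k ω) n ^ 2) μ :=
    integrable_sq (measurable_altSum fun k _ => h.measurable k)
      fun ω => abs_altSum_le (fun k => h.bounded k ω) n
  rw [← integral_div, ← integral_div, ← integral_add (hA.div_const _) (hB.div_const _)]
  refine integral_mono (integrable_sq (measurable_drift γ fun k _ => h.measurable k)
    fun ω => abs_drift_le hγ (fun k => h.bounded k ω) n)
    ((hA.div_const _).add (hB.div_const _)) fun ω => ?_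
  simp only [drift]
  set A := ∑ k ∈ Finset.range n, x k ω
  set B := altSum (fun k => x k ω) n
  rw [← add_div, div_pow]
  refine div_le_div_of_nonneg_right ?_ (sq_nonneg _)
  have he : ((-1 : ℝ) ^ n) ^ 2 = 1 := by rw [← pow_mul, mul_comm, pow_mul]; simp
  have hγ2 : γ ^ 2 ≤ 1 / 4 := by
    rw [← sq_abs]; nlinarith [abs_nonneg γ]
  calc (γ * A + (-1) ^ n * B / 2) ^ 2
      ≤ 2 * (γ ^ 2 * A ^ 2) + ((-1 : ℝ) ^ n) ^ 2 * B ^ 2 / 2 := by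
        nlinarith [sq_nonneg (γ * A - (-1) ^ n * B / 2)]
    _ ≤ A ^ 2 + B ^ 2 := by
        rw [he]
        nlinarith [mul_le_mul_of_nonneg_right hγ2 (sq_nonneg A), sq_nonneg A, sq_nonneg B]

theorem tendsto_integral_abs_drift (h : IsMemoryProcess μ F γ C x) (hγ : |γ| ≤ 1 / 2) :
    Tendsto (fun n : ℕ => ∫ ω, |drift γ (fun k => x k ω) n| ∂μ) atTop (𝓝 0) := by
  have h1 := (h.tendsto_integral_drift_sq hγ).sqrt
  rw [Real.sqrt_zero] at h1
  exact squeeze_zero (fun n => integral_nonneg fun ω => abs_nonneg _)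
    (fun n => Real.le_sqrt_of_sq_le (sq_integral_abs_le
      (measurable_drift γ fun k _ => h.measurable k)
      fun ω => abs_drift_le hγ (fun k => h.bounded k ω) n)) h1

end IsMemoryProcess

end Memory


/-! ### Convergence of the characteristic functions -/

theorem norm_exp_I_mul_sub_exp_I_mul_le (a b : ℝ) :
    ‖Complex.exp (Complex.I * a) - Complex.exp (Complex.I * b)‖ ≤ |a - b| := by
  have e : Complex.exp (Complex.I * a) - Complex.exp (Complex.I * b) =
      Complex.exp (Complex.I * b) * (Complex.exp (Complex.I * ((a - b : ℝ) : ℂ)) - 1) := by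
    rw [mul_sub, mul_one, ← Complex.exp_add]; congr 2; push_cast; ring
  rw [e, norm_mul, Complex.norm_exp_I_mul_ofReal, one_mul]
  exact Real.norm_exp_I_mul_ofReal_sub_one_le

theorem norm_exp_I_mul_sub_quadratic_le {a : ℝ} (ha : |a| ≤ 1) :
    ‖Complex.exp (Complex.I * a) - 1 - Complex.I * a + (a : ℂ) ^ 2 / 2‖ ≤ |a| ^ 3 := by
  have hn : ‖Complex.I * (a : ℂ)‖ = |a| := by simp
  have := Complex.exp_bound (x := Complex.I * a) (by rwa [hn]) (n := 3) (by norm_num)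
  rw [hn] at this
  simp only [Finset.sum_range_succ, Finset.sum_range_zero, mul_pow, Complex.I_sq] at this
  norm_num [Nat.factorial] at this
  have e : Complex.exp (Complex.I * a) - 1 - Complex.I * a + (a : ℂ) ^ 2 / 2 =
      Complex.exp (Complex.I * a) - (1 + Complex.I * a + -(a : ℂ) ^ 2 / 2) := by ring
  rw [e]
  have h3 : 0 ≤ |a| ^ 3 := by positivity
  linarith

/-- Factors of modulus at most `1` do not amplify earlier errors, so one-step errors simply add up.
-/
theorem norm_sub_prod_range_le {φ : ℕ → ℂ} {q d : ℕ → ℝ} (h0 : φ 0 = 1)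
    (hq : ∀ k, |q k| ≤ 1) (n : ℕ) (h : ∀ k, ‖φ (k + 1) - φ k * q k‖ ≤ d k) :
    ‖φ n - ∏ k ∈ Finset.range n, (q k : ℂ)‖ ≤ ∑ k ∈ Finset.range n, d k := by
  induction n with
  | zero => simp [h0]
  | succ n ih =>
    rw [Finset.prod_range_succ, Finset.sum_range_succ]
    have e : φ (n + 1) - (∏ k ∈ Finset.range n, (q k : ℂ)) * q n =
        (φ n - ∏ k ∈ Finset.range n, (q k : ℂ)) * q n + (φ (n + 1) - φ n * q n) := by ring
    rw [e]
    refine (norm_add_le _ _).trans (add_le_add ?_ (h n))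
    rw [norm_mul, Complex.norm_real]
    exact (mul_le_of_le_one_right (norm_nonneg _) (hq n)).trans ih

namespace IsMemoryProcess

variable {Ω : Type*} {mΩ : MeasurableSpace Ω} {μ : Measure Ω} [IsProbabilityMeasure μ]
  {F : Filtration ℕ mΩ} {γ C C' s : ℝ} {x : ℕ → Ω → ℝ}

/-- This identifies the conditional variance of the noise. With `D` and `E` the drifts of `x` and
`x² - s`, the bracket equals `(x² - s - E) - 2 D (x - D)`, and both parts are orthogonal to the
past. -/
theorem integral_mul_noise_sq (h : IsMemoryProcess μ F γ C x) (hγ : |γ| ≤ 1 / 2)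
    (h' : IsMemoryProcess μ F γ C' fun n ω => x n ω ^ 2 - s) (n : ℕ)
    {Z : Ω → ℂ} (hZ : Measurable[F n] Z) (hK : ∀ ω, ‖Z ω‖ ≤ 1) :
    ∫ ω, Z ω * ((noise γ (fun k => x k ω) n ^ 2 - s - drift γ (fun k => x k ω ^ 2 - s) n +
      drift γ (fun k => x k ω) n ^ 2 : ℝ) : ℂ) ∂μ = 0 := by
  have hD : Measurable[F n] fun ω => drift γ (fun k => x k ω) n :=
    measurable_drift γ h.measurable_of_lt
  have hDb : ∀ ω, |drift γ (fun k => x k ω) n| ≤ C := fun ω =>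
    abs_drift_le hγ (fun k => h.bounded k ω) n
  have hDb' : ∀ ω, |drift γ (fun k => x k ω ^ 2 - s) n| ≤ C' := fun ω =>
    abs_drift_le hγ (fun k => h'.bounded k ω) n
  have hZD : Measurable[F n] fun ω => Z ω * (drift γ (fun k => x k ω) n : ℂ) :=
    hZ.mul (Complex.measurable_ofReal.comp hD)
  have hZDb : ∀ ω, ‖Z ω * (drift γ (fun k => x k ω) n : ℂ)‖ ≤ C := fun ω => by
    rw [norm_mul, Complex.norm_real]
    exact (mul_le_of_le_one_left (norm_nonneg _) (hK ω)).trans (hDb ω)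
  have h1 := h'.integral_mul_sub_drift hγ n hZ hK
  have h2 := h.integral_mul_sub_drift hγ n hZD hZDb
  have hi1 : Integrable (fun ω => Z ω *
      ((x n ω ^ 2 - s - drift γ (fun k => x k ω ^ 2 - s) n : ℝ) : ℂ)) μ :=
    integrable_of_forall_norm_le ((hZ.mono (F.le n) le_rfl).mul (Complex.measurable_ofReal.comp
      ((h'.measurable n).sub (measurable_drift γ fun k _ => h'.measurable k)))) (K := C' + C')
      fun ω => by
        rw [norm_mul, Complex.norm_real]
        refine (mul_le_of_le_one_left (norm_nonneg _) (hK ω)).trans ?_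
        exact (abs_sub _ _).trans (add_le_add (h'.bounded n ω) (hDb' ω))
  have hi2 : Integrable (fun ω => Z ω * (drift γ (fun k => x k ω) n : ℂ) *
      ((x n ω - drift γ (fun k => x k ω) n : ℝ) : ℂ)) μ :=
    integrable_of_forall_norm_le ((hZD.mono (F.le n) le_rfl).mul
      (Complex.measurable_ofReal.comp
        ((h.measurable n).sub (measurable_drift γ fun k _ => h.measurable k))))
      (K := C * (C + C)) fun ω => by
        rw [norm_mul, Complex.norm_real]
        exact mul_le_mul (hZDb ω) ((abs_sub _ _).trans (add_le_add (h.bounded n ω) (hDb ω)))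
          (norm_nonneg _) ((abs_nonneg _).trans (hDb ω))
  calc _ = ∫ ω, (Z ω * ((x n ω ^ 2 - s - drift γ (fun k => x k ω ^ 2 - s) n : ℝ) : ℂ) -
        2 * (Z ω * (drift γ (fun k => x k ω) n : ℂ) *
          ((x n ω - drift γ (fun k => x k ω) n : ℝ) : ℂ))) ∂μ := by
        congr 1; ext ω
        have he : ((-1 : ℂ) ^ n) ^ 2 = 1 := by rw [← pow_mul, mul_comm, pow_mul]; simp
        simp only [noise]
        push_cast
        linear_combination
          (Z ω * ((x n ω : ℂ) - (drift γ (fun k => x k ω) n : ℂ)) ^ 2) * he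
    _ = 0 := by
        rw [integral_sub hi1 (hi2.const_mul 2), integral_const_mul, h1, h2]; simp

/-- The three errors are the cubic Taylor remainder of the imaginary exponential, the deviation of
the conditional variance from `s`, and the Taylor remainder of the Gaussian factor. -/
theorem norm_integral_mul_exp_noise_sub_le (h : IsMemoryProcess μ F γ C x) (hγ : |γ| ≤ 1 / 2)
    (h' : IsMemoryProcess μ F γ C' fun n ω => x n ω ^ 2 - s) (hs : 0 ≤ s) (n : ℕ)
    {Z : Ω → ℂ} (hZ : Measurable[F n] Z) (hK : ∀ ω, ‖Z ω‖ ≤ 1) {w : ℝ} (hw : 0 ≤ w)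
    (hwC : w * (2 * C) ≤ 1) (hws : w ^ 2 * s / 2 ≤ 1) :
    ‖∫ ω, Z ω * (Complex.exp (Complex.I * ((w * noise γ (fun k => x k ω) n : ℝ) : ℂ)) -
      (Real.exp (-(w ^ 2 * s / 2)) : ℂ)) ∂μ‖ ≤
      (w * (2 * C)) ^ 3 + w ^ 2 / 2 * (∫ ω, drift γ (fun k => x k ω) n ^ 2 ∂μ +
        ∫ ω, |drift γ (fun k => x k ω ^ 2 - s) n| ∂μ) + (w ^ 2 * s / 2) ^ 2 := by
  have hD : Measurable fun ω => drift γ (fun k => x k ω) n :=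
    measurable_drift γ fun k _ => h.measurable k
  have hDb : ∀ ω, |drift γ (fun k => x k ω) n| ≤ C := fun ω =>
    abs_drift_le hγ (fun k => h.bounded k ω) n
  have hE : Measurable fun ω => drift γ (fun k => x k ω ^ 2 - s) n :=
    measurable_drift γ fun k _ => h'.measurable k
  have hEb : ∀ ω, |drift γ (fun k => x k ω ^ 2 - s) n| ≤ C' := fun ω =>
    abs_drift_le hγ (fun k => h'.bounded k ω) n
  have hN : Measurable fun ω => noise γ (fun k => x k ω) n :=
    measurable_noise γ fun k _ => h.measurable k
  have hNb : ∀ ω, |noise γ (fun k => x k ω) n| ≤ 2 * C := fun ω =>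
    abs_noise_le hγ (fun k => h.bounded k ω) n
  have hZ' : Measurable Z := hZ.mono (F.le n) le_rfl
  have hcast : ∀ {f : Ω → ℝ}, Measurable f → Measurable fun ω => ((f ω : ℝ) : ℂ) :=
    fun hf => Complex.measurable_ofReal.comp hf
  have hint : ∀ {f : Ω → ℂ}, Measurable f → ∀ K, (∀ ω, ‖f ω‖ ≤ K) →
      Integrable (fun ω => Z ω * f ω) μ := fun {f} hf K hb =>
    integrable_of_forall_norm_le (hZ'.mul hf) (K := K) fun ω => by
      rw [norm_mul]; exact (mul_le_of_le_one_left (norm_nonneg _) (hK ω)).trans (hb ω)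
  have hbD : Integrable (fun ω => drift γ (fun k => x k ω) n ^ 2) μ := integrable_sq hD hDb
  have hbE : Integrable (fun ω => |drift γ (fun k => x k ω ^ 2 - s) n|) μ :=
    integrable_of_forall_norm_le (measurable_abs.comp hE) (K := C') (by simpa using hEb)
  have i1 := h.integral_mul_noise hγ n hZ hK
  have i2 := h.integral_mul_noise_sq hγ h' n hZ hK
  have j1 : Integrable (fun ω => Z ω * (noise γ (fun k => x k ω) n : ℂ)) μ :=
    hint (hcast hN) (2 * C) (by simpa using hNb)
  have j2 : Integrable (fun ω => Z ω * ((noise γ (fun k => x k ω) n ^ 2 - s -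
      drift γ (fun k => x k ω ^ 2 - s) n + drift γ (fun k => x k ω) n ^ 2 : ℝ) : ℂ)) μ := by
    refine hint (hcast ((((hN.pow_const 2).sub_const s).sub hE).add (hD.pow_const 2)))
      ((2 * C) ^ 2 + s + C' + C ^ 2) fun ω => ?_
    rw [Complex.norm_real]
    have a1 := pow_le_pow_left₀ (abs_nonneg _) (hNb ω) 2
    have a2 := pow_le_pow_left₀ (abs_nonneg _) (hDb ω) 2
    rw [sq_abs] at a1 a2
    have a3 := abs_le.1 (hEb ω)
    refine abs_le.2 ⟨?_, ?_⟩ <;>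
      nlinarith [sq_nonneg (noise γ (fun k => x k ω) n), sq_nonneg (drift γ (fun k => x k ω) n)]
  set T : Ω → ℂ := fun ω =>
    Complex.exp (Complex.I * ((w * noise γ (fun k => x k ω) n : ℝ) : ℂ)) -
      (Real.exp (-(w ^ 2 * s / 2)) : ℂ) with hT
  have hTm : Measurable T :=
    (Complex.measurable_exp.comp ((hcast (hN.const_mul w)).const_mul _)).sub_const _
  have hTb : ∀ ω, ‖T ω‖ ≤ 2 := fun ω => by
    refine (norm_sub_le _ _).trans ?_
    rw [Complex.norm_exp_I_mul_ofReal, Complex.norm_real, Real.norm_of_nonneg (Real.exp_pos _).le]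
    have : Real.exp (-(w ^ 2 * s / 2)) ≤ 1 := Real.exp_le_one_iff.2 (by
      have : 0 ≤ w ^ 2 * s / 2 := by positivity
      linarith)
    linarith
  -- Both added terms have zero integral; they cancel the linear and quadratic terms pointwise, so
  -- the rest can be bounded under the integral.
  have e : ∫ ω, Z ω * T ω ∂μ = ∫ ω, (Z ω * T ω - Complex.I * w *
      (Z ω * (noise γ (fun k => x k ω) n : ℂ)) + (w : ℂ) ^ 2 / 2 *
      (Z ω * ((noise γ (fun k => x k ω) n ^ 2 - s - drift γ (fun k => x k ω ^ 2 - s) n +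
        drift γ (fun k => x k ω) n ^ 2 : ℝ) : ℂ))) ∂μ := by
    have j3 : Integrable (fun ω => Z ω * T ω - Complex.I * w *
        (Z ω * (noise γ (fun k => x k ω) n : ℂ))) μ :=
      (hint hTm 2 hTb).sub (j1.const_mul _)
    rw [integral_add j3 (j2.const_mul _), integral_sub (hint hTm 2 hTb) (j1.const_mul _),
      integral_const_mul, integral_const_mul, i1, i2]
    simp
  change ‖∫ ω, Z ω * T ω ∂μ‖ ≤ _
  rw [e]
  have hR : Integrable (fun ω => (w * (2 * C)) ^ 3 + w ^ 2 / 2 *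
      (drift γ (fun k => x k ω) n ^ 2 + |drift γ (fun k => x k ω ^ 2 - s) n|) +
      (w ^ 2 * s / 2) ^ 2) μ :=
    ((integrable_const _).add ((hbD.add hbE).const_mul _)).add (integrable_const _)
  refine (norm_integral_le_of_norm_le hR (ae_of_all _ fun ω => ?_)).trans_eq ?_
  · have hwN : |w * noise γ (fun k => x k ω) n| ≤ w * (2 * C) := by
      rw [abs_mul, abs_of_nonneg hw]; exact mul_le_mul_of_nonneg_left (hNb ω) hw
    have b1 := norm_exp_I_mul_sub_quadratic_le (hwN.trans hwC)
    have b2 := pow_le_pow_left₀ (abs_nonneg _) hwN 3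
    have b3 := Real.abs_exp_sub_one_sub_id_le (x := -(w ^ 2 * s / 2)) (by
      rw [abs_neg, abs_of_nonneg (by positivity)]; exact hws)
    rw [neg_sq] at b3
    simp only [hT]
    set ε := noise γ (fun k => x k ω) n
    set D := drift γ (fun k => x k ω) n
    set E := drift γ (fun k => x k ω ^ 2 - s) n
    set r := Real.exp (-(w ^ 2 * s / 2))
    have e2 : Z ω * (Complex.exp (Complex.I * ((w * ε : ℝ) : ℂ)) - (r : ℂ)) -
        Complex.I * w * (Z ω * (ε : ℂ)) +
        (w : ℂ) ^ 2 / 2 * (Z ω * ((ε ^ 2 - s - E + D ^ 2 : ℝ) : ℂ)) =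
        Z ω * ((Complex.exp (Complex.I * ((w * ε : ℝ) : ℂ)) - 1 -
          Complex.I * ((w * ε : ℝ) : ℂ) + ((w * ε : ℝ) : ℂ) ^ 2 / 2) +
          ((w ^ 2 / 2 * (D ^ 2 - E) : ℝ) : ℂ) -
          ((r - 1 - -(w ^ 2 * s / 2) : ℝ) : ℂ)) := by
      push_cast; ring
    rw [e2, norm_mul]
    refine (mul_le_of_le_one_left (norm_nonneg _) (hK ω)).trans ?_
    refine (norm_sub_le _ _).trans (add_le_add ((norm_add_le _ _).trans
      (add_le_add (b1.trans b2) ?_)) ?_)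
    · rw [Complex.norm_real, norm_mul, Real.norm_of_nonneg (by positivity)]
      refine mul_le_mul_of_nonneg_left ?_ (by positivity)
      refine (abs_sub _ _).trans ?_
      rw [abs_of_nonneg (sq_nonneg D)]
    · rw [Complex.norm_real]; exact b3
  · have j4 : Integrable (fun ω => w ^ 2 / 2 *
      (drift γ (fun k => x k ω) n ^ 2 + |drift γ (fun k => x k ω ^ 2 - s) n|)) μ :=
      (hbD.add hbE).const_mul _
    have j5 : Integrable (fun ω => (w * (2 * C)) ^ 3 + w ^ 2 / 2 *
      (drift γ (fun k => x k ω) n ^ 2 + |drift γ (fun k => x k ω ^ 2 - s) n|)) μ :=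
      (integrable_const _).add j4
    rw [integral_add j5 (integrable_const _), integral_add (integrable_const _) j4,
      integral_const_mul, integral_add hbD hbE]
    simp

theorem tendsto_integral_exp_noiseSum (h : IsMemoryProcess μ F γ C x) (hγ : |γ| ≤ 1 / 2)
    (h' : IsMemoryProcess μ F γ C' fun n ω => x n ω ^ 2 - s) (hs : 0 ≤ s) :
    Tendsto (fun n : ℕ => ∫ ω, Complex.exp (Complex.I *
      ((noiseSum γ (fun k => x k ω) n / √(Real.log n) : ℝ) : ℂ)) ∂μ) atTop
      (𝓝 (Real.exp (-(s / 2)) : ℂ)) := by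
  have hC : 0 ≤ C := by
    obtain ⟨ω₀⟩ : Nonempty Ω := nonempty_of_isProbabilityMeasure μ
    exact (abs_nonneg _).trans (h.bounded 0 ω₀)
  set v : ℕ → ℝ := fun k => ∫ ω, drift γ (fun k => x k ω) k ^ 2 ∂μ +
        ∫ ω, |drift γ (fun k => x k ω ^ 2 - s) k| ∂μ with hv
  -- The one-step error at index `k` will be at most `w k ^ 2 * e k`, with `w k ^ 2 = 1 / ((k+1) log
  -- n)`.
  set e : ℕ → ℝ := fun k => (2 * C) ^ 3 * (1 / √((k : ℝ) + 1)) + v k / 2 +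
    s ^ 2 / 4 * (1 / ((k : ℝ) + 1)) with he
  have hi : Tendsto (fun n : ℕ => (1 : ℝ) / ((n : ℝ) + 1)) atTop (𝓝 0) :=
    tendsto_one_div_add_atTop_nhds_zero_nat
  have hsq : Tendsto (fun n : ℕ => (1 : ℝ) / √((n : ℝ) + 1)) atTop (𝓝 0) := by
    have := hi.sqrt
    rw [Real.sqrt_zero] at this
    refine this.congr fun n => ?_
    rw [Real.sqrt_div zero_le_one, Real.sqrt_one]
  have he0 : Tendsto e atTop (𝓝 0) := by
    have hv0 := (h.tendsto_integral_drift_sq hγ).add (h'.tendsto_integral_abs_drift hγ)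
    have := ((hsq.const_mul ((2 * C) ^ 3)).add (hv0.div_const 2)).add (hi.const_mul (s ^ 2 / 4))
    simpa [he, hv] using this
  have hmain : ∀ᶠ n : ℕ in atTop, ‖∫ ω, Complex.exp (Complex.I *
      ((noiseSum γ (fun k => x k ω) n / √(Real.log n) : ℝ) : ℂ)) ∂μ -
      (Real.exp (-(s / 2 * ((∑ k ∈ Finset.range n, 1 / ((k : ℝ) + 1)) / Real.log n))) : ℂ)‖ ≤
      (∑ k ∈ Finset.range n, 1 / ((k : ℝ) + 1) * e k) / Real.log n := by
    -- The thresholds give, for every `k`, `w k ≤ 1/√(k+1)`, `w k * (2C) ≤ 1` and `w k ^ 2 * s / 2 ≤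
    -- 1`.
    filter_upwards [tendsto_log_natCast.eventually_ge_atTop 1,
      tendsto_log_natCast.eventually_ge_atTop ((2 * C) ^ 2),
      tendsto_log_natCast.eventually_ge_atTop s] with n hL1 hL2 hL3
    set L := Real.log n
    have hL0 : 0 < L := by linarith
    have hsL : 1 ≤ √L := Real.one_le_sqrt.2 hL1
    have hsL2 : √L ^ 2 = L := Real.sq_sqrt hL0.le
    -- The normalisation `L = log n` stays frozen while `k` runs up to `n`.
    set φ : ℕ → ℂ := fun k => ∫ ω, Complex.exp (Complex.I *
      ((noiseSum γ (fun k => x k ω) k / √L : ℝ) : ℂ)) ∂μ with hφ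
    set w : ℕ → ℝ := fun k => 1 / (√((k : ℝ) + 1) * √L) with hw
    have hw0 : ∀ k, 0 ≤ w k := fun k => by positivity
    have hw2 : ∀ k, w k ^ 2 = 1 / ((k : ℝ) + 1) / L := fun k => by
      simp only [hw]
      rw [div_pow, mul_pow, Real.sq_sqrt (by positivity), hsL2, one_pow, div_div]
    have hk1 : ∀ k : ℕ, 1 ≤ √((k : ℝ) + 1) := fun k =>
      Real.one_le_sqrt.2 (by linarith [k.cast_nonneg (α := ℝ)])
    have hwle : ∀ k, w k ≤ 1 / √((k : ℝ) + 1) := fun k => by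
      simp only [hw]
      exact one_div_le_one_div_of_le (by positivity)
        (le_mul_of_one_le_right (by positivity) hsL)
    have hw2le : ∀ k, w k ^ 2 ≤ 1 / ((k : ℝ) + 1) := fun k => by
      rw [hw2]; exact div_le_self (by positivity) hL1
    have hwC : ∀ k, w k * (2 * C) ≤ 1 := fun k => by
      simp only [hw]
      rw [one_div_mul_eq_div, div_le_one (by positivity)]
      have : 2 * C ≤ √L := Real.le_sqrt_of_sq_le hL2
      nlinarith [hk1 k]
    have hws : ∀ k, w k ^ 2 * s / 2 ≤ 1 := fun k => by
      have h1 : w k ^ 2 ≤ 1 / L := by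
        rw [hw2]
        refine div_le_div_of_nonneg_right ?_ hL0.le
        rw [div_le_one (by positivity)]; linarith [k.cast_nonneg (α := ℝ)]
      have h2 : w k ^ 2 * s ≤ 1 / L * s := mul_le_mul_of_nonneg_right h1 hs
      have h3 : 1 / L * s ≤ 1 := by rw [one_div_mul_eq_div, div_le_one hL0]; exact hL3
      linarith
    have hstep : ∀ k, ‖φ (k + 1) - φ k * (Real.exp (-(w k ^ 2 * s / 2)) : ℝ)‖ ≤
        1 / ((k : ℝ) + 1) * e k / L := fun k => by
      have hM : Measurable[F k] fun ω => Complex.exp (Complex.I *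
          ((noiseSum γ (fun k => x k ω) k / √L : ℝ) : ℂ)) :=
        Complex.measurable_exp.comp ((Complex.measurable_ofReal.comp
          ((measurable_noiseSum γ h.measurable_of_lt).div_const _)).const_mul _)
      have hM' := hM.mono (F.le k) le_rfl
      have hMb : ∀ ω, ‖Complex.exp (Complex.I *
          ((noiseSum γ (fun k => x k ω) k / √L : ℝ) : ℂ))‖ ≤ 1 := fun ω =>
        (Complex.norm_exp_I_mul_ofReal _).le
      have hM1 : Measurable fun ω => Complex.exp (Complex.I *
          ((noiseSum γ (fun k => x k ω) (k + 1) / √L : ℝ) : ℂ)) :=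
        Complex.measurable_exp.comp ((Complex.measurable_ofReal.comp
          ((measurable_noiseSum γ fun k _ => h.measurable k).div_const _)).const_mul _)
      have hMb1 : ∀ ω, ‖Complex.exp (Complex.I *
          ((noiseSum γ (fun k => x k ω) (k + 1) / √L : ℝ) : ℂ))‖ ≤ 1 := fun ω =>
        (Complex.norm_exp_I_mul_ofReal _).le
      have hb := h.norm_integral_mul_exp_noise_sub_le hγ h' hs k hM hMb (hw0 k) (hwC k) (hws k)
      have heq : φ (k + 1) - φ k * (Real.exp (-(w k ^ 2 * s / 2)) : ℝ) =
          ∫ ω, Complex.exp (Complex.I * ((noiseSum γ (fun k => x k ω) k / √L : ℝ) : ℂ)) *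
            (Complex.exp (Complex.I * ((w k * noise γ (fun k => x k ω) k : ℝ) : ℂ)) -
              (Real.exp (-(w k ^ 2 * s / 2)) : ℂ)) ∂μ := by
        simp only [hφ]
        rw [← integral_mul_const, ← integral_sub (integrable_of_forall_norm_le hM1 hMb1)
          ((integrable_of_forall_norm_le hM' hMb).mul_const _)]
        congr 1; ext ω
        rw [mul_sub, ← Complex.exp_add, ← mul_add, ← Complex.ofReal_add]
        congr 5
        simp only [noiseSum, Finset.sum_range_succ, hw]
        field_simp
      rw [heq]
      refine hb.trans ?_
      have hv0 : 0 ≤ v k := add_nonneg (integral_nonneg fun ω => sq_nonneg _)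
        (integral_nonneg fun ω => abs_nonneg _)
      change (w k * (2 * C)) ^ 3 + w k ^ 2 / 2 * v k + (w k ^ 2 * s / 2) ^ 2 ≤ _
      calc (w k * (2 * C)) ^ 3 + w k ^ 2 / 2 * v k + (w k ^ 2 * s / 2) ^ 2
          = w k ^ 2 * ((2 * C) ^ 3 * w k + v k / 2 + s ^ 2 / 4 * w k ^ 2) := by ring
        _ ≤ w k ^ 2 * e k := by
          refine mul_le_mul_of_nonneg_left ?_ (sq_nonneg _)
          simp only [he]
          have a1 := mul_le_mul_of_nonneg_left (hwle k) (by positivity : 0 ≤ (2 * C) ^ 3)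
          have a2 := mul_le_mul_of_nonneg_left (hw2le k) (by positivity : 0 ≤ s ^ 2 / 4)
          linarith
        _ = 1 / ((k : ℝ) + 1) * e k / L := by rw [hw2]; ring
    have hφ0 : φ 0 = 1 := by simp [hφ, noiseSum]
    have htel := norm_sub_prod_range_le hφ0 (fun k => by
      rw [abs_of_pos (Real.exp_pos _)]
      refine Real.exp_le_one_iff.2 ?_
      have : 0 ≤ w k ^ 2 * s / 2 := by positivity
      linarith) n hstep
    rw [← Complex.ofReal_prod, ← Real.exp_sum, ← Finset.sum_div] at htel
    convert htel using 5
    rw [Finset.sum_neg_distrib, ← Finset.sum_div, ← Finset.sum_mul]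
    simp_rw [hw2]
    rw [← Finset.sum_div]
    ring
  have hexp : Tendsto (fun n : ℕ => (Real.exp (-(s / 2 *
      ((∑ k ∈ Finset.range n, 1 / ((k : ℝ) + 1)) / Real.log n))) : ℂ)) atTop
      (𝓝 (Real.exp (-(s / 2)) : ℂ)) := by
    have := (tendsto_harmonic_div_log.const_mul (s / 2)).neg
    rw [mul_one] at this
    exact (Complex.continuous_ofReal.tendsto _).comp ((Real.continuous_exp.tendsto _).comp this)
  have hdiff := squeeze_zero_norm' hmain (tendsto_sum_div_log_of_tendsto_zero he0)
  simpa using hdiff.add hexp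

/-- The characteristic function of a bounded perturbation of the alternating sum, normalised by
`√(n * log n)`, converges to the one of a centred Gaussian variable. -/
theorem tendsto_integral_exp_div_sqrt (h : IsMemoryProcess μ F γ C x) (hγ : |γ| ≤ 1 / 2)
    (h' : IsMemoryProcess μ F γ C' fun n ω => x n ω ^ 2 - s) (hs : 0 ≤ s) {P : ℕ → Ω → ℝ}
    (hP : ∀ n, Measurable (P n)) {b : ℝ}
    (hb : ∀ n ω, |P n ω - altSum (fun k => x k ω) n| ≤ b) :
    Tendsto (fun n : ℕ => ∫ ω, Complex.exp (Complex.I *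
      ((P n ω / √((n : ℝ) * Real.log n) : ℝ) : ℂ)) ∂μ) atTop
      (𝓝 (Real.exp (-(s / 2)) : ℂ)) := by
  obtain ⟨ω₀⟩ : Nonempty Ω := nonempty_of_isProbabilityMeasure μ
  have hb0 : 0 ≤ b := (abs_nonneg _).trans (hb 0 ω₀)
  obtain ⟨K, hK⟩ := exists_abs_altSum_div_sqrt_sub_noiseSum_le hγ
    ((abs_nonneg _).trans (h.bounded 0 ω₀))
  have hlim : Tendsto (fun n : ℕ => (b + K) / √(Real.log n)) atTop (𝓝 0) :=
    tendsto_const_nhds.div_atTop (Real.tendsto_sqrt_atTop.comp tendsto_log_natCast)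
  have hexpm : ∀ {f : Ω → ℝ}, Measurable f →
      Integrable (fun ω => Complex.exp (Complex.I * ((f ω : ℝ) : ℂ))) μ := fun hf =>
    integrable_of_forall_norm_le (Complex.measurable_exp.comp
      ((Complex.measurable_ofReal.comp hf).const_mul _)) (K := 1)
      fun ω => (Complex.norm_exp_I_mul_ofReal _).le
  have hdiff : Tendsto (fun n : ℕ => ∫ ω, Complex.exp (Complex.I *
      ((P n ω / √((n : ℝ) * Real.log n) : ℝ) : ℂ)) ∂μ - ∫ ω, Complex.exp (Complex.I *
      ((noiseSum γ (fun k => x k ω) n / √(Real.log n) : ℝ) : ℂ)) ∂μ) atTop (𝓝 0) := by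
    refine squeeze_zero_norm' ?_ hlim
    filter_upwards [tendsto_log_natCast.eventually_ge_atTop 1, eventually_ge_atTop 1] with n hL hn
    have h1n : 1 ≤ √(n : ℝ) := Real.one_le_sqrt.2 (by exact_mod_cast hn)
    have hsL : 0 < √(Real.log n) := Real.sqrt_pos.2 (by linarith)
    rw [← integral_sub (hexpm ((hP n).div_const _))
      (hexpm ((measurable_noiseSum γ fun k _ => h.measurable k).div_const _))]
    refine (norm_integral_le_of_norm_le (integrable_const ((b + K) / √(Real.log n)))
      (ae_of_all _ fun ω => ?_)).trans_eq (by simp)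
    refine (norm_exp_I_mul_sub_exp_I_mul_le _ _).trans ?_
    have h1 := hK (fun k => x k ω) (fun k => h.bounded k ω) n
    have h2 : |(P n ω - altSum (fun k => x k ω) n) / √(n : ℝ)| ≤ b := by
      rw [abs_div, abs_of_pos (by linarith : 0 < √(n : ℝ))]
      exact (div_le_self (abs_nonneg _) h1n).trans (hb n ω)
    have e : P n ω / √((n : ℝ) * Real.log n) - noiseSum γ (fun k => x k ω) n / √(Real.log n) =
        ((P n ω - altSum (fun k => x k ω) n) / √(n : ℝ) +
          (altSum (fun k => x k ω) n / √(n : ℝ) - noiseSum γ (fun k => x k ω) n)) /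
          √(Real.log n) := by
      rw [Real.sqrt_mul n.cast_nonneg]
      field_simp
      ring
    rw [e, abs_div, abs_of_pos hsL]
    exact div_le_div_of_nonneg_right ((abs_add_le _ _).trans (add_le_add h2 h1)) hsL.le
  simpa using hdiff.add (h.tendsto_integral_exp_noiseSum hγ h' hs)

end IsMemoryProcess


/-! ### The elephant random walk -/

section Walk

variable {d : ℕ} {Sev Sodd : Set (EuclideanSpace ℝ (Fin d))}
  {Vodd Vev : Finset (EuclideanSpace ℝ (Fin d))} {p q : ℝ}

/-! ### Step sets under alternating signs, and means under the jump law -/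

theorem IsStepSystem.neg_mem_even (hV : IsStepSystem Sev Sodd Vodd Vev)
    {v : EuclideanSpace ℝ (Fin d)} : -v ∈ Vev ↔ v ∈ Vodd := by
  have h : v ∈ (Vodd : Set (EuclideanSpace ℝ (Fin d))) ↔ v ∈ -(Vev : Set _) := by
    rw [hV.odd_eq_neg_even]
  simpa using h.symm

theorem IsStepSystem.neg_mem_odd (hV : IsStepSystem Sev Sodd Vodd Vev)
    {v : EuclideanSpace ℝ (Fin d)} : -v ∈ Vodd ↔ v ∈ Vev := by
  rw [← hV.neg_mem_even, neg_neg]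

theorem IsStepSystem.neg_one_pow_smul_mem (hV : IsStepSystem Sev Sodd Vodd Vev) (n : ℕ)
    {v : EuclideanSpace ℝ (Fin d)} :
    (-1 : ℝ) ^ n • v ∈ Vodd ↔ v ∈ stepSet Vodd Vev (n + 1) := by
  rcases Nat.even_or_odd n with h | h
  · simp [stepSet, h.neg_one_pow, h.add_one]
  · have : ¬ Odd (n + 1) := Nat.not_odd_iff_even.2 h.add_one
    simp [stepSet, h.neg_one_pow, this, hV.neg_mem_odd]

theorem neg_one_pow_smul_smul (n : ℕ) (v : EuclideanSpace ℝ (Fin d)) :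
    (-1 : ℝ) ^ n • (-1 : ℝ) ^ n • v = v := by
  rw [smul_smul, ← mul_pow]; simp

theorem IsStepSystem.sum_stepSet (hV : IsStepSystem Sev Sodd Vodd Vev) (n : ℕ)
    {M : Type*} [AddCommMonoid M] (g : EuclideanSpace ℝ (Fin d) → M) :
    ∑ w ∈ stepSet Vodd Vev (n + 1), g ((-1 : ℝ) ^ n • w) = ∑ v ∈ Vodd, g v :=
  Finset.sum_bij' (fun w _ => (-1 : ℝ) ^ n • w) (fun v _ => (-1 : ℝ) ^ n • v)
    (fun w hw => (hV.neg_one_pow_smul_mem n).2 hw)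
    (fun v hv => (hV.neg_one_pow_smul_mem n).1 (by rwa [neg_one_pow_smul_smul]))
    (fun w _ => neg_one_pow_smul_smul n w) (fun v _ => neg_one_pow_smul_smul n v)
    (fun _ _ => rfl)

theorem IsStepSystem.card_stepSet (hV : IsStepSystem Sev Sodd Vodd Vev) (n : ℕ) :
    (stepSet Vodd Vev (n + 1)).card = Vodd.card := by
  have := hV.sum_stepSet n fun _ => 1
  simpa using this

theorem stepSet_subset_union (k : ℕ) {v : EuclideanSpace ℝ (Fin d)}
    (hv : v ∈ stepSet Vodd Vev k) : v ∈ (Vodd ∪ Vev : Set (EuclideanSpace ℝ (Fin d))) := by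
  unfold stepSet at hv
  split_ifs at hv
  · exact Or.inl hv
  · exact Or.inr hv

theorem IsStepSystem.notMem_stepSet (hV : IsStepSystem Sev Sodd Vodd Vev) {j k : ℕ}
    (hjk : ¬ (Odd j ↔ Odd k)) {v : EuclideanSpace ℝ (Fin d)} (hv : v ∈ stepSet Vodd Vev j) :
    v ∉ stepSet Vodd Vev k := by
  unfold stepSet at *
  by_cases hj : Odd j <;> by_cases hk : Odd k <;> simp only [hj, hk, if_true, if_false] at * <;>
    simp at hjk
  · exact Finset.disjoint_left.1 hV.disjoint hv
  · exact Finset.disjoint_right.1 hV.disjoint hv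

/-- The uniform part of the law integrates `g` to zero; what survives is the excess mass at `v`,
namely `r - (1-r)/(m-1) = (m r - 1)/(m-1)`. -/
theorem sum_ite_eq_memoryCoeff (r : ℝ) {W : Finset (EuclideanSpace ℝ (Fin d))} (hW : 2 ≤ W.card)
    {v : EuclideanSpace ℝ (Fin d)} (hv : v ∈ W) {g : EuclideanSpace ℝ (Fin d) → ℝ}
    (hg : ∑ w ∈ W, g w = 0) [∀ w, Decidable (v = w)] :
    ∑ w ∈ W, (if v = w then r else (1 - r) / ((W.card : ℝ) - 1)) * g w =
      memoryCoeff W.card r * g v := by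
  have hm : (W.card : ℝ) - 1 ≠ 0 := by
    have : (2 : ℝ) ≤ W.card := by exact_mod_cast hW
    linarith
  have e : ∀ w, (if v = w then r else (1 - r) / ((W.card : ℝ) - 1)) * g w =
      (1 - r) / ((W.card : ℝ) - 1) * g w +
        if v = w then (r - (1 - r) / ((W.card : ℝ) - 1)) * g w else 0 := fun w => by
    split_ifs <;> ring
  simp_rw [e]
  rw [Finset.sum_add_distrib, ← Finset.mul_sum, hg, Finset.sum_eq_single v
    (fun w _ hw => if_neg hw.symm) (fun hw => absurd hv hw), if_pos rfl, memoryCoeff]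
  field_simp
  ring

/-- In signed coordinates the favoured value is always the remembered signed step: the step itself
for equal parities, its negative for opposite ones. The sign `(-1)^n (-1)^k` merges the two
coefficients `α = γ + δ` and `β = γ - δ`. -/
theorem IsStepSystem.sum_jumpProb (hV : IsStepSystem Sev Sodd Vodd Vev) {k n : ℕ}
    {v : EuclideanSpace ℝ (Fin d)} (hv : v ∈ stepSet Vodd Vev (k + 1))
    {h : EuclideanSpace ℝ (Fin d) → ℝ} (hh : ∑ v ∈ Vodd, h v = 0) :
    ∑ w ∈ stepSet Vodd Vev (n + 1),
        jumpProb p q (stepSet Vodd Vev (n + 1)) v w * h ((-1 : ℝ) ^ n • w) =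
      ((memoryCoeff Vodd.card p + memoryCoeff Vodd.card q) / 2 +
        (-1) ^ n * (-1) ^ k * ((memoryCoeff Vodd.card p - memoryCoeff Vodd.card q) / 2)) *
        h ((-1 : ℝ) ^ k • v) := by
  have hcard := hV.card_stepSet n
  have h2 : 2 ≤ (stepSet Vodd Vev (n + 1)).card := hcard ▸ hV.two_le_card
  have hg := (hV.sum_stepSet n h).trans hh
  have hkk : (-1 : ℝ) ^ k * (-1) ^ k = 1 := by rw [← mul_pow]; simp
  by_cases hp : Odd (k + 1) ↔ Odd (n + 1)
  · have hv' : v ∈ stepSet Vodd Vev (n + 1) := by unfold stepSet at *; simpa only [hp] using hv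
    have hs : (-1 : ℝ) ^ n = (-1) ^ k := by
      rcases Nat.even_or_odd n with hn | hn <;> rcases Nat.even_or_odd k with hk | hk
      · rw [hn.neg_one_pow, hk.neg_one_pow]
      · exact absurd hp (by simp [Nat.odd_add_one, hn, hk])
      · exact absurd hp (by simp [Nat.odd_add_one, hn, hk])
      · rw [hn.neg_one_pow, hk.neg_one_pow]
    simp only [jumpProb, if_pos hv']
    rw [sum_ite_eq_memoryCoeff p h2 hv' hg, hcard, hs, hkk]
    ring
  · have hv' : v ∉ stepSet Vodd Vev (n + 1) := hV.notMem_stepSet hp hv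
    have hs : (-1 : ℝ) ^ n = -(-1) ^ k := by
      rcases Nat.even_or_odd n with hn | hn <;> rcases Nat.even_or_odd k with hk | hk
      · exact absurd (by simp [hn, hk]) hp
      · rw [hn.neg_one_pow, hk.neg_one_pow, neg_neg]
      · rw [hn.neg_one_pow, hk.neg_one_pow]
      · exact absurd (by simp [Nat.odd_add_one, hn, hk]) hp
    have hs2 : (-1 : ℝ) ^ n • -v = (-1 : ℝ) ^ k • v := by rw [hs]; simp
    have hnv : -v ∈ stepSet Vodd Vev (n + 1) := by
      rw [← hV.neg_one_pow_smul_mem, hs2, hV.neg_one_pow_smul_mem]; exact hv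
    simp only [jumpProb, if_neg hv']
    rw [sum_ite_eq_memoryCoeff q h2 hnv hg, hcard, hs2, hs, neg_mul, hkk]
    ring

variable {Ω : Type*} {mΩ : MeasurableSpace Ω} {μ : Measure Ω}
  {X₁ : Ω → EuclideanSpace ℝ (Fin d)} {U : ℕ → Ω → ℕ}
  {G : ℕ → EuclideanSpace ℝ (Fin d) → Ω → EuclideanSpace ℝ (Fin d)}

/-! ### History filtration and measurability of the steps -/

theorem IsInput.innovation_le (hin : IsInput μ Vodd Vev p q X₁ U G) (n : ℕ) :
    innovation Vodd Vev X₁ U G n ≤ mΩ := by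
  cases n with
  | zero => exact hin.first_measurable.comap_le
  | succ n =>
    exact sup_le (hin.time_measurable (n + 1) (by omega)).comap_le
      (iSup₂_le fun v hv => (hin.map_measurable (n + 2) (by omega) v hv).comap_le)

/-- The `σ`-algebra generated by the first `n` sources of randomness. -/
def IsInput.history (hin : IsInput μ Vodd Vev p q X₁ U G) : Filtration ℕ mΩ where
  seq n := ⨆ i ∈ Set.Iio n, innovation Vodd Vev X₁ U G i
  mono' _ _ h := biSup_mono fun _ hi => lt_of_lt_of_le hi h
  le' _ := iSup₂_le fun i _ => hin.innovation_le i

theorem IsInput.innovation_le_history (hin : IsInput μ Vodd Vev p q X₁ U G) {i n : ℕ}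
    (h : i < n) : innovation Vodd Vev X₁ U G i ≤ hin.history n :=
  le_iSup₂_of_le (f := fun i (_ : i ∈ Set.Iio n) => innovation Vodd Vev X₁ U G i) i h le_rfl

theorem IsInput.indep_history_innovation (hin : IsInput μ Vodd Vev p q X₁ U G) (n : ℕ) :
    Indep (hin.history n) (innovation Vodd Vev X₁ U G n) μ := by
  have := indep_iSup_of_disjoint hin.innovation_le hin.indep_innovation
    (S := Set.Iio n) (T := {n}) (by simp)
  rwa [iSup_singleton] at this

theorem measurable_time_innovation {n : ℕ} (hn : 1 ≤ n) :
    Measurable[innovation Vodd Vev X₁ U G n] (U n) := by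
  obtain ⟨k, rfl⟩ : ∃ k, n = k + 1 := ⟨n - 1, by omega⟩
  exact (comap_measurable (U (k + 1))).mono le_sup_left le_rfl

theorem measurable_map_innovation {n : ℕ} (hn : 1 ≤ n) {v : EuclideanSpace ℝ (Fin d)}
    (hv : v ∈ (Vodd ∪ Vev : Set (EuclideanSpace ℝ (Fin d)))) :
    Measurable[innovation Vodd Vev X₁ U G n] (G (n + 1) v) := by
  obtain ⟨k, rfl⟩ : ∃ k, n = k + 1 := ⟨n - 1, by omega⟩
  refine (comap_measurable (G (k + 2) v)).mono (le_trans ?_ le_sup_right) le_rfl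
  exact le_iSup₂_of_le (f := fun v (_ : v ∈ (Vodd ∪ Vev : Set (EuclideanSpace ℝ (Fin d)))) =>
    MeasurableSpace.comap (G (k + 2) v) inferInstance) v hv le_rfl

theorem IsInput.time_bounds (hin : IsInput μ Vodd Vev p q X₁ U G) {n : ℕ} (hn : 1 ≤ n) (ω : Ω) :
    1 ≤ U n ω ∧ U n ω ≤ n :=
  Finset.mem_Icc.1 (hin.time_mem n hn ω)

theorem IsInput.step_mem (hin : IsInput μ Vodd Vev p q X₁ U G) (k : ℕ) (ω : Ω) :
    step X₁ U G (k + 1) ω ∈ stepSet Vodd Vev (k + 1) := by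
  induction k using Nat.strong_induction_on with
  | _ k ih =>
    rcases Nat.eq_zero_or_pos k with rfl | hk
    · rw [zero_add, step_one]; simpa [stepSet] using hin.first_mem ω
    · obtain ⟨h1, h2⟩ := hin.time_bounds hk ω
      rw [step_succ X₁ U G k hk ω h2]
      obtain ⟨u, hu⟩ : ∃ u, U k ω = u + 1 := ⟨U k ω - 1, by omega⟩
      refine hin.map_mem (k + 1) (by omega) _ ?_ ω
      rw [hu]
      exact stepSet_subset_union _ (ih u (by omega))

theorem IsInput.measurable_step (hin : IsInput μ Vodd Vev p q X₁ U G) (k : ℕ) :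
    Measurable[hin.history (k + 1)] (step X₁ U G (k + 1)) := by
  induction k using Nat.strong_induction_on with
  | _ k ih =>
    rcases Nat.eq_zero_or_pos k with rfl | hk
    · have : step X₁ U G (0 + 1) = X₁ := funext fun ω => step_one X₁ U G ω
      rw [this]
      exact (comap_measurable X₁).mono (hin.innovation_le_history (i := 0) (by omega)) le_rfl
    · intro s hs
      -- Each `G (k + 1) v` is measurable only for fixed `v`, so the event is split over the
      -- finitely many remembered times and values.
      have e : step X₁ U G (k + 1) ⁻¹' s = ⋃ u ∈ Finset.range k, ⋃ v ∈ Vodd ∪ Vev,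
          (U k ⁻¹' {u + 1} ∩ step X₁ U G (u + 1) ⁻¹' {v}) ∩ G (k + 1) v ⁻¹' s := by
        ext ω
        obtain ⟨h1, h2⟩ := hin.time_bounds hk ω
        simp only [Set.mem_preimage, Set.mem_iUnion, Set.mem_inter_iff, Set.mem_singleton_iff,
          exists_prop, Finset.mem_range]
        rw [step_succ X₁ U G k hk ω h2]
        constructor
        · intro hω
          obtain ⟨u, hu⟩ : ∃ u, U k ω = u + 1 := ⟨U k ω - 1, by omega⟩
          refine ⟨u, by omega, step X₁ U G (u + 1) ω, ?_, ⟨hu, rfl⟩, by rwa [← hu]⟩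
          have := stepSet_subset_union _ (hin.step_mem u ω)
          simpa using this
        · rintro ⟨u, _, v, _, ⟨hu, hv⟩, hω⟩
          rwa [hu, hv]
      rw [e]
      have hle := hin.innovation_le_history k.lt_succ_self
      refine Finset.measurableSet_biUnion _ fun u hu => Finset.measurableSet_biUnion _ fun v hv => ?_
      refine MeasurableSet.inter (MeasurableSet.inter ?_ ?_) ?_
      · exact hle _ (measurable_time_innovation hk (measurableSet_singleton _))
      · exact hin.history.mono (by have := Finset.mem_range.1 hu; omega) _
          (ih u (Finset.mem_range.1 hu) (measurableSet_singleton v))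
      · exact hle _ (measurable_map_innovation hk (by simpa using hv) hs)

/-! ### Conditional mean of the next signed step -/

theorem integral_comp_eq_sum [IsProbabilityMeasure μ] {f : Ω → EuclideanSpace ℝ (Fin d)}
    (hf : Measurable f) {W : Finset (EuclideanSpace ℝ (Fin d))} (hW : ∀ ω, f ω ∈ W)
    (g : EuclideanSpace ℝ (Fin d) → ℝ) :
    ∫ ω, g (f ω) ∂μ = ∑ w ∈ W, μ.real {ω | f ω = w} * g w := by
  classical
  have hm : ∀ w, MeasurableSet {ω | f ω = w} := fun w => hf (measurableSet_singleton w)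
  have e : ∀ ω, g (f ω) = ∑ w ∈ W, {ω | f ω = w}.indicator (fun _ => g w) ω := fun ω => by
    simp only [Set.indicator_apply, Set.mem_ofPred_eq]
    rw [Finset.sum_ite_eq, if_pos (hW ω)]
  simp_rw [e]
  rw [integral_finsetSum _ fun w _ => (integrable_const (g w)).indicator (hm w)]
  refine Finset.sum_congr rfl fun w _ => ?_
  rw [integral_indicator_const _ (hm w), smul_eq_mul]

theorem integral_mul_of_indep {m₁ m₂ : MeasurableSpace Ω} (h₁ : m₁ ≤ mΩ) (h₂ : m₂ ≤ mΩ)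
    (h : Indep m₁ m₂ μ) {f g : Ω → ℂ} (hf : Measurable[m₁] f) (hg : Measurable[m₂] g) :
    ∫ ω, f ω * g ω ∂μ = (∫ ω, f ω ∂μ) * ∫ ω, g ω ∂μ := by
  have hfg : IndepFun f g μ := by
    rw [IndepFun_iff_Indep]
    exact indep_of_indep_of_le_left (indep_of_indep_of_le_right h hg.comap_le) hf.comap_le
  exact hfg.integral_fun_mul_eq_mul_integral (hf.mono h₁ le_rfl).aestronglyMeasurable
    (hg.mono h₂ le_rfl).aestronglyMeasurable

theorem IsInput.integral_time_mul_map [IsProbabilityMeasure μ]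
    (hin : IsInput μ Vodd Vev p q X₁ U G) {n : ℕ} (hn : 1 ≤ n) {u : ℕ} (hu : u < n)
    {v : EuclideanSpace ℝ (Fin d)} (hv : v ∈ (Vodd ∪ Vev : Set (EuclideanSpace ℝ (Fin d))))
    {g : EuclideanSpace ℝ (Fin d) → ℝ} (hg : Measurable g) :
    ∫ ω, (U n ⁻¹' {u + 1}).indicator (fun _ => (1 : ℂ)) ω * (g (G (n + 1) v ω) : ℂ) ∂μ =
      ((1 / (n : ℝ) * ∑ w ∈ stepSet Vodd Vev (n + 1),
        jumpProb p q (stepSet Vodd Vev (n + 1)) v w * g w : ℝ) : ℂ) := by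
  have hU := hin.time_measurable n hn
  have hGm := hin.map_measurable (n + 1) (by omega) v hv
  have hGc : Measurable[⨆ v ∈ (Vodd ∪ Vev : Set (EuclideanSpace ℝ (Fin d))),
      MeasurableSpace.comap (G (n + 1) v) inferInstance] (G (n + 1) v) :=
    (comap_measurable (G (n + 1) v)).mono (le_iSup₂_of_le
      (f := fun v (_ : v ∈ (Vodd ∪ Vev : Set (EuclideanSpace ℝ (Fin d)))) =>
        MeasurableSpace.comap (G (n + 1) v) inferInstance) v hv le_rfl) le_rfl
  rw [integral_mul_of_indep (g := fun ω => (g (G (n + 1) v ω) : ℂ)) hU.comap_le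
    (iSup₂_le fun v hv => (hin.map_measurable (n + 1) (by omega) v hv).comap_le)
    (hin.indep_time_map n hn)
    (measurable_const.indicator (comap_measurable (U n) (measurableSet_singleton (u + 1))))
    (Complex.measurable_ofReal.comp (hg.comp hGc))]
  rw [integral_indicator_const _ (hU (measurableSet_singleton _)), integral_complex_ofReal,
    integral_comp_eq_sum hGm (hin.map_mem (n + 1) (by omega) v hv) g]
  have h1 : μ.real (U n ⁻¹' {u + 1}) = 1 / (n : ℝ) :=
    hin.time_law n hn (u + 1) (Finset.mem_Icc.2 ⟨by omega, by omega⟩)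
  have h2 : ∀ w ∈ stepSet Vodd Vev (n + 1), μ.real {ω | G (n + 1) v ω = w} * g w =
      jumpProb p q (stepSet Vodd Vev (n + 1)) v w * g w := fun w hw => by
    rw [hin.map_law (n + 1) (by omega) v hv w hw]
  rw [h1, Finset.sum_congr rfl h2, Complex.real_smul, mul_one, Complex.ofReal_mul]

/-- The steps of the walk, multiplied by alternating signs so that all of them are odd. -/
def signedStep (X₁ : Ω → EuclideanSpace ℝ (Fin d)) (U : ℕ → Ω → ℕ)
    (G : ℕ → EuclideanSpace ℝ (Fin d) → Ω → EuclideanSpace ℝ (Fin d)) (k : ℕ) (ω : Ω) :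
    EuclideanSpace ℝ (Fin d) :=
  (-1 : ℝ) ^ k • step X₁ U G (k + 1) ω

theorem IsInput.signedStep_mem (hin : IsInput μ Vodd Vev p q X₁ U G)
    (hV : IsStepSystem Sev Sodd Vodd Vev) (k : ℕ) (ω : Ω) : signedStep X₁ U G k ω ∈ Vodd :=
  (hV.neg_one_pow_smul_mem k).2 (hin.step_mem k ω)

theorem IsInput.measurable_signedStep (hin : IsInput μ Vodd Vev p q X₁ U G) (k : ℕ) :
    Measurable[hin.history (k + 1)] (signedStep X₁ U G k) :=
  (hin.measurable_step k).const_smul ((-1 : ℝ) ^ k)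

theorem IsInput.integral_mul_signedStep_zero [IsProbabilityMeasure μ]
    (hin : IsInput μ Vodd Vev p q X₁ U G) {h : EuclideanSpace ℝ (Fin d) → ℝ} (hm : Measurable h)
    (hh : ∑ v ∈ Vodd, h v = 0) {Z : Ω → ℂ} (hZ : Measurable[hin.history 0] Z) :
    ∫ ω, Z ω * (h (signedStep X₁ U G 0 ω) : ℂ) ∂μ = 0 := by
  have e : ∀ ω, signedStep X₁ U G 0 ω = X₁ ω := fun ω => by simp [signedStep, step_one]
  simp_rw [e]
  have hX : Measurable[innovation Vodd Vev X₁ U G 0] X₁ := comap_measurable X₁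
  rw [integral_mul_of_indep (g := fun ω => (h (X₁ ω) : ℂ)) (hin.history.le 0) (hin.innovation_le 0)
    (hin.indep_history_innovation 0) hZ (Complex.measurable_ofReal.comp (hm.comp hX)),
    integral_complex_ofReal, integral_comp_eq_sum hin.first_measurable hin.first_mem h,
    Finset.sum_congr rfl fun v hv => by rw [hin.first_law v hv], ← Finset.mul_sum, hh]
  simp

/-- After splitting over the remembered time and value, each term is a past factor times a factor of
the fresh innovation, and independence applies twice: between these two, then between `U n` and `G
(n + 1) v`. -/
theorem IsInput.integral_mul_signedStep [IsProbabilityMeasure μ]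
    (hin : IsInput μ Vodd Vev p q X₁ U G) (hV : IsStepSystem Sev Sodd Vodd Vev)
    {h : EuclideanSpace ℝ (Fin d) → ℝ} (hm : Measurable h)
    (hh : ∑ v ∈ Vodd, h v = 0) {C : ℝ} (hC : ∀ v ∈ Vodd, |h v| ≤ C) {n : ℕ} (hn : 1 ≤ n)
    {Z : Ω → ℂ} (hZ : Measurable[hin.history n] Z) {K : ℝ} (hK : ∀ ω, ‖Z ω‖ ≤ K) :
    ∫ ω, Z ω * (h (signedStep X₁ U G n ω) : ℂ) ∂μ =
      ∑ k ∈ Finset.range n, ∫ ω, Z ω * ((1 / (n : ℝ) *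
        (((memoryCoeff Vodd.card p + memoryCoeff Vodd.card q) / 2 +
          (-1) ^ n * (-1) ^ k * ((memoryCoeff Vodd.card p - memoryCoeff Vodd.card q) / 2)) *
        h (signedStep X₁ U G k ω)) : ℝ) : ℂ) ∂μ := by
  classical
  set W := stepSet Vodd Vev (n + 1) with hW
  set g : EuclideanSpace ℝ (Fin d) → ℝ := fun w => h ((-1 : ℝ) ^ n • w) with hg
  have hgm : Measurable g := hm.comp (measurable_const_smul _)
  have hZ' := hZ.mono (hin.history.le n) le_rfl
  have hstepm : ∀ k < n, ∀ v, MeasurableSet[hin.history n] (step X₁ U G (k + 1) ⁻¹' {v}) :=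
    fun k hk v => hin.history.mono (by omega) _
      (hin.measurable_step k (measurableSet_singleton v))
  have hI : ∀ k < n, ∀ v, Measurable[hin.history n] fun ω =>
      Z ω * (step X₁ U G (k + 1) ⁻¹' {v}).indicator (fun _ => (1 : ℂ)) ω := fun k hk v =>
    hZ.mul (measurable_const.indicator (hstepm k hk v))
  have hJ : ∀ k < n, ∀ v ∈ (Vodd ∪ Vev : Set (EuclideanSpace ℝ (Fin d))),
      Measurable[innovation Vodd Vev X₁ U G n] fun ω =>
        (U n ⁻¹' {k + 1}).indicator (fun _ => (1 : ℂ)) ω * (g (G (n + 1) v ω) : ℂ) :=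
    fun k hk v hv =>
      (measurable_const.indicator (measurable_time_innovation hn
        (measurableSet_singleton (k + 1)))).mul
      (Complex.measurable_ofReal.comp (hgm.comp (measurable_map_innovation hn hv)))
  have hind : ∀ (s : Set Ω) ω, ‖s.indicator (fun _ => (1 : ℂ)) ω‖ ≤ 1 := fun s ω => by
    by_cases hω : ω ∈ s <;> simp [hω]
  have hmemV : ∀ k ω, step X₁ U G (k + 1) ω ∈ Vodd ∪ Vev := fun k ω => by
    have := stepSet_subset_union _ (hin.step_mem k ω)
    simpa using this
  have hV' : ∀ {v}, v ∈ Vodd ∪ Vev → v ∈ (Vodd ∪ Vev : Set (EuclideanSpace ℝ (Fin d))) :=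
    fun hv => by simpa using hv
  have expand : ∀ ω, Z ω * (h (signedStep X₁ U G n ω) : ℂ) =
      ∑ k ∈ Finset.range n, ∑ v ∈ Vodd ∪ Vev,
        (Z ω * (step X₁ U G (k + 1) ⁻¹' {v}).indicator (fun _ => (1 : ℂ)) ω) *
        ((U n ⁻¹' {k + 1}).indicator (fun _ => (1 : ℂ)) ω * (g (G (n + 1) v ω) : ℂ)) := fun ω => by
    obtain ⟨h1, h2⟩ := hin.time_bounds hn ω
    obtain ⟨u, hu⟩ : ∃ u, U n ω = u + 1 := ⟨U n ω - 1, by omega⟩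
    rw [Finset.sum_eq_single u, Finset.sum_eq_single (step X₁ U G (u + 1) ω)]
    · simp only [Set.indicator_apply, Set.mem_preimage, Set.mem_singleton_iff, hu, if_true,
        mul_one, one_mul, signedStep, hg]
      rw [step_succ X₁ U G n hn ω h2, hu]
    · intro v _ hv
      simp [Set.indicator_apply, hv.symm]
    · intro hv
      exact absurd (hmemV u ω) hv
    · intro k _ hk
      refine Finset.sum_eq_zero fun v _ => ?_
      simp [Set.indicator_apply, hu, hk.symm]
    · intro hk
      exact absurd (Finset.mem_range.2 (by omega)) hk
  -- The reverse splitting: once the innovation is integrated out, the sum over the remembered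
  -- values collapses.
  have hcollect : ∀ k < n, ∀ ω, Z ω * ((1 / (n : ℝ) *
        (((memoryCoeff Vodd.card p + memoryCoeff Vodd.card q) / 2 +
          (-1) ^ n * (-1) ^ k * ((memoryCoeff Vodd.card p - memoryCoeff Vodd.card q) / 2)) *
        h (signedStep X₁ U G k ω)) : ℝ) : ℂ) =
      ∑ v ∈ Vodd ∪ Vev,
        (Z ω * (step X₁ U G (k + 1) ⁻¹' {v}).indicator (fun _ => (1 : ℂ)) ω) *
          ((1 / (n : ℝ) * ∑ w ∈ W, jumpProb p q W v w * g w : ℝ) : ℂ) := fun k hk ω => by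
    rw [Finset.sum_eq_single (step X₁ U G (k + 1) ω)]
    · rw [hW, hg, hV.sum_jumpProb (hin.step_mem k ω) hh]
      simp [signedStep]
    · intro v _ hv
      simp [hv.symm]
    · intro hv
      exact absurd (hmemV k ω) hv
  have hgb : ∀ k < n, ∀ v ∈ Vodd ∪ Vev, Integrable (fun ω =>
      (Z ω * (step X₁ U G (k + 1) ⁻¹' {v}).indicator (fun _ => (1 : ℂ)) ω) *
        ((U n ⁻¹' {k + 1}).indicator (fun _ => (1 : ℂ)) ω * (g (G (n + 1) v ω) : ℂ))) μ :=
    fun k hk v hv => integrable_of_forall_norm_le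
      (((hI k hk v).mono (hin.history.le n) le_rfl).mul
        ((hJ k hk v (hV' hv)).mono (hin.innovation_le n) le_rfl)) (K := K * 1 * (1 * C))
      fun ω => by
        have hK0 : 0 ≤ K := (norm_nonneg _).trans (hK ω)
        have hGC : ‖(g (G (n + 1) v ω) : ℂ)‖ ≤ C := by
          rw [Complex.norm_real]
          exact hC _ ((hV.neg_one_pow_smul_mem n).2
            (hin.map_mem (n + 1) (by omega) v (hV' hv) ω))
        rw [norm_mul, norm_mul, norm_mul]
        exact mul_le_mul (mul_le_mul (hK ω) (hind _ ω) (norm_nonneg _) hK0)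
          (mul_le_mul (hind _ ω) hGC (norm_nonneg _) zero_le_one) (by positivity) (by positivity)
  have hIi : ∀ k < n, ∀ v, Integrable (fun ω =>
      Z ω * (step X₁ U G (k + 1) ⁻¹' {v}).indicator (fun _ => (1 : ℂ)) ω) μ :=
    fun k hk v => integrable_of_forall_norm_le ((hI k hk v).mono (hin.history.le n) le_rfl)
      (K := K * 1) fun ω => by
        rw [norm_mul]
        exact mul_le_mul (hK ω) (hind _ ω) (norm_nonneg _) ((norm_nonneg _).trans (hK ω))
  rw [integral_congr_ae (ae_of_all _ expand), integral_finsetSum _ fun k hk =>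
    integrable_finsetSum _ fun v hv => hgb k (Finset.mem_range.1 hk) v hv]
  refine Finset.sum_congr rfl fun k hk => ?_
  have hkn := Finset.mem_range.1 hk
  rw [integral_finsetSum _ fun v hv => hgb k hkn v hv,
    integral_congr_ae (ae_of_all _ (hcollect k hkn)),
    integral_finsetSum _ fun v _ => (hIi k hkn v).mul_const _]
  refine Finset.sum_congr rfl fun v hv => ?_
  rw [integral_mul_of_indep (hin.history.le n) (hin.innovation_le n)
    (hin.indep_history_innovation n) (hI k hkn v) (hJ k hkn v (hV' hv)),
    hin.integral_time_mul_map hn hkn (hV' hv) hgm, integral_mul_const]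

theorem IsInput.isMemoryProcess [IsProbabilityMeasure μ]
    (hin : IsInput μ Vodd Vev p q X₁ U G) (hV : IsStepSystem Sev Sodd Vodd Vev)
    (hδ : delta Vodd.card p q = 1 / 2)
    {h : EuclideanSpace ℝ (Fin d) → ℝ} (hm : Measurable h)
    (hh : ∑ v ∈ Vodd, h v = 0) {C : ℝ} (hC : ∀ v ∈ Vodd, |h v| ≤ C) :
    IsMemoryProcess μ hin.history ((memoryCoeff Vodd.card p + memoryCoeff Vodd.card q) / 2) C
      fun k ω => h (signedStep X₁ U G k ω) where
  adapted k := hm.comp (hin.measurable_signedStep k)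
  bounded k ω := hC _ (hin.signedStep_mem hV k ω)
  integral_mul n Z hZ hK := by
    obtain ⟨K, hK⟩ := hK
    -- For `n = 0` the drift is `0`, which agrees with the uniform law of `X₁` and the zero sum of
    -- `h`.
    rcases Nat.eq_zero_or_pos n with rfl | hn
    · rw [hin.integral_mul_signedStep_zero hm hh hZ]
      simp [drift]
    · rw [hin.integral_mul_signedStep hV hm hh hC hn hZ hK, ← integral_finsetSum]
      · congr 1; ext ω
        rw [delta] at hδ
        rw [← Finset.mul_sum, ← Complex.ofReal_sum, hδ, drift, altSum]
        congr 2
        simp_rw [add_mul]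
        rw [← Finset.mul_sum, Finset.sum_add_distrib, ← Finset.mul_sum, one_div,
          inv_mul_eq_div]
        congr 2
        rw [Finset.mul_sum, Finset.sum_div]
        exact Finset.sum_congr rfl fun k _ => by ring
      · intro k _
        have hx : Measurable fun ω => h (signedStep X₁ U G k ω) :=
          hm.comp ((hin.measurable_signedStep k).mono (hin.history.le _) le_rfl)
        set c := (memoryCoeff Vodd.card p + memoryCoeff Vodd.card q) / 2 +
          (-1) ^ n * (-1) ^ k * ((memoryCoeff Vodd.card p - memoryCoeff Vodd.card q) / 2)
        refine integrable_of_forall_norm_le ((hZ.mono (hin.history.le n) le_rfl).mul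
          (Complex.measurable_ofReal.comp ((hx.const_mul c).const_mul (1 / (n : ℝ)))))
          (K := K * (|1 / (n : ℝ)| * (|c| * C))) fun ω => ?_
        have := hC _ (hin.signedStep_mem hV k ω)
        rw [norm_mul, Complex.norm_real, Real.norm_eq_abs, abs_mul, abs_mul]
        exact mul_le_mul (hK ω) (by gcongr) (by positivity) ((norm_nonneg _).trans (hK ω))

/-! ### Range of the parameter, limit covariance and projections of the position -/

/-- Criticality forces `γ + 1/2 = α ≤ 1` and `γ - 1/2 = β ≥ -1`, so the bound on `γ` is automatic.
-/
theorem abs_memoryCoeff_add_div_two_le {m : ℕ} (hm : 2 ≤ m) (hp : p ≤ 1) (hq : 0 ≤ q)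
    (hδ : delta m p q = 1 / 2) : |(memoryCoeff m p + memoryCoeff m q) / 2| ≤ 1 / 2 := by
  have hm' : (2 : ℝ) ≤ m := by exact_mod_cast hm
  have h1 : memoryCoeff m p ≤ 1 := by
    rw [memoryCoeff, div_le_one (by linarith)]; nlinarith
  have h2 : -1 ≤ memoryCoeff m q := by
    rw [memoryCoeff, le_div_iff₀ (by linarith)]; nlinarith
  rw [delta] at hδ
  rw [abs_le]; constructor <;> linarith

theorem sum_sub_meanStep (hV : 2 ≤ Vodd.card) :
    ∑ v ∈ Vodd, (v - meanStep Vodd) = 0 := by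
  have : (Vodd.card : ℝ) ≠ 0 := by positivity
  rw [Finset.sum_sub_distrib, Finset.sum_const, meanStep, ← Nat.cast_smul_eq_nsmul ℝ, smul_smul,
    mul_one_div_cancel this, one_smul, sub_self]

theorem posSemidef_limitCov : (limitCov Vodd).PosSemidef := by
  refine Matrix.PosSemidef.smul (Matrix.posSemidef_sum _ fun v _ => ?_) (by positivity)
  simpa using Matrix.posSemidef_vecMulVec_self_star (v - meanStep Vodd).ofLp

theorem dotProduct_limitCov_mulVec (t : EuclideanSpace ℝ (Fin d)) :
    t.ofLp ⬝ᵥ (limitCov Vodd).mulVec t.ofLp =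
      1 / (Vodd.card : ℝ) * ∑ v ∈ Vodd, inner ℝ (v - meanStep Vodd) t ^ 2 := by
  rw [limitCov, Matrix.smul_mulVec, dotProduct_smul, Matrix.sum_mulVec, dotProduct_sum,
    smul_eq_mul]
  congr 1
  refine Finset.sum_congr rfl fun v _ => ?_
  rw [Matrix.vecMulVec_mulVec, dotProduct_smul, EuclideanSpace.inner_eq_star_dotProduct]
  simp [dotProduct_comm, sq]

/-- The signs of `signedStep` and `altSum` cancel; only the alternating sum of the constant `v̄`
remains, and it is bounded. -/
theorem inner_position (t : EuclideanSpace ℝ (Fin d)) (n : ℕ) (ω : Ω) :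
    inner ℝ (position X₁ U G n ω) t -
      altSum (fun k => inner ℝ (signedStep X₁ U G k ω - meanStep Vodd) t) n =
      (∑ k ∈ Finset.range n, (-1) ^ k) * inner ℝ (meanStep Vodd) t := by
  rw [position, sum_inner, altSum, ← Finset.sum_sub_distrib, Finset.sum_mul]
  refine Finset.sum_congr rfl fun k _ => ?_
  have : ((-1 : ℝ) ^ k) * (-1) ^ k = 1 := by rw [← mul_pow]; simp
  rw [inner_sub_left, signedStep, real_inner_smul_left]
  linear_combination (-inner ℝ (step X₁ U G (k + 1) ω) t) * this

theorem abs_sum_neg_one_pow_le (n : ℕ) : |∑ k ∈ Finset.range n, (-1 : ℝ) ^ k| ≤ 1 := by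
  rw [neg_one_geom_sum]; split_ifs <;> simp

theorem IsInput.measurable_position (hin : IsInput μ Vodd Vev p q X₁ U G) (n : ℕ) :
    Measurable (position X₁ U G n) :=
  Finset.measurable_fun_sum _ fun k _ => (hin.measurable_step k).mono (hin.history.le _) le_rfl

theorem IsInput.tendsto_integral_exp_inner_position [IsProbabilityMeasure μ]
    (hin : IsInput μ Vodd Vev p q X₁ U G) (hV : IsStepSystem Sev Sodd Vodd Vev)
    (hp : p ≤ 1) (hq : 0 ≤ q) (hδ : delta Vodd.card p q = 1 / 2)
    (t : EuclideanSpace ℝ (Fin d)) :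
    Tendsto (fun n : ℕ => ∫ ω, Complex.exp (Complex.I *
      ((inner ℝ (position X₁ U G n ω) t / √((n : ℝ) * Real.log n) : ℝ) : ℂ)) ∂μ) atTop
      (𝓝 (Real.exp (-(t.ofLp ⬝ᵥ (limitCov Vodd).mulVec t.ofLp / 2)) : ℂ)) := by
  set h : EuclideanSpace ℝ (Fin d) → ℝ := fun v => inner ℝ (v - meanStep Vodd) t with hh
  have hm : Measurable h := by fun_prop
  have hcard : (Vodd.card : ℝ) ≠ 0 := by have := hV.two_le_card; positivity
  set s := 1 / (Vodd.card : ℝ) * ∑ v ∈ Vodd, h v ^ 2 with hs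
  have hs0 : 0 ≤ s := mul_nonneg (by positivity) (Finset.sum_nonneg fun v _ => sq_nonneg _)
  have h0 : ∑ v ∈ Vodd, h v = 0 := by
    simp only [hh]
    rw [← sum_inner, sum_sub_meanStep hV.two_le_card, inner_zero_left]
  -- This zero sum makes the centred squares a memory process too, with the same `γ`.
  have h0' : ∑ v ∈ Vodd, (h v ^ 2 - s) = 0 := by
    rw [Finset.sum_sub_distrib, Finset.sum_const, nsmul_eq_mul, hs]; field_simp; simp
  have hb : ∀ f : EuclideanSpace ℝ (Fin d) → ℝ, ∀ v ∈ Vodd, |f v| ≤ ∑ v ∈ Vodd, |f v| :=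
    fun f v hv => Finset.single_le_sum (f := fun v => |f v|) (fun w _ => abs_nonneg _) hv
  have hx := hin.isMemoryProcess hV hδ hm h0 (hb h)
  have hx' := hin.isMemoryProcess hV hδ (h := fun v => h v ^ 2 - s)
    ((hm.pow_const 2).sub_const s) h0' (hb _)
  rw [dotProduct_limitCov_mulVec]
  refine hx.tendsto_integral_exp_div_sqrt
    (abs_memoryCoeff_add_div_two_le hV.two_le_card hp hq hδ) hx' hs0
    (P := fun n ω => inner ℝ (position X₁ U G n ω) t)
    (fun n => (hin.measurable_position n).inner_const) (b := |inner ℝ (meanStep Vodd) t|)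
    fun n ω => ?_
  simp only [hh]
  rw [inner_position, abs_mul]
  exact mul_le_of_le_one_left (abs_nonneg _) (abs_sum_neg_one_pow_le n)

end Walk

end

end ERW

theorem mainTheorem2 {d : ℕ} {Ω : Type*} [MeasurableSpace Ω] (μ : Measure Ω)
    [IsProbabilityMeasure μ]
    (Sev Sodd : Set (EuclideanSpace ℝ (Fin d))) (Vodd Vev : Finset (EuclideanSpace ℝ (Fin d)))
    (hV : ERW.IsStepSystem Sev Sodd Vodd Vev)
    (p q : ℝ) (hp : p ∈ Set.Icc (0 : ℝ) 1) (hq : q ∈ Set.Icc (0 : ℝ) 1)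
    (X₁ : Ω → EuclideanSpace ℝ (Fin d)) (U : ℕ → Ω → ℕ)
    (G : ℕ → EuclideanSpace ℝ (Fin d) → Ω → EuclideanSpace ℝ (Fin d))
    (hin : ERW.IsInput μ Vodd Vev p q X₁ U G)
    (hδ : ERW.delta Vodd.card p q = 1 / 2) :
    TendstoInDistribution
      (fun (n : ℕ) (ω : Ω) =>
        (1 / Real.sqrt ((n : ℝ) * Real.log (n : ℝ))) • ERW.position X₁ U G n ω)
      atTop (id : EuclideanSpace ℝ (Fin d) → EuclideanSpace ℝ (Fin d)) (fun _ => μ)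
      (multivariateGaussian (0 : EuclideanSpace ℝ (Fin d)) (ERW.limitCov Vodd)) := by
  have hmeas : ∀ n : ℕ, Measurable fun ω =>
      (1 / Real.sqrt ((n : ℝ) * Real.log (n : ℝ))) • ERW.position X₁ U G n ω :=
    fun n => (hin.measurable_position n).const_smul (1 / Real.sqrt ((n : ℝ) * Real.log (n : ℝ)))
  -- Lévy's continuity theorem; the Gaussian characteristic function needs only a positive
  -- semidefinite covariance, so a singular one is allowed.
  refine ⟨fun n => (hmeas n).aemeasurable, aemeasurable_id,
    ProbabilityMeasure.tendsto_of_tendsto_charFun fun t => ?_⟩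
  change Tendsto (fun n : ℕ => charFun (μ.map fun ω =>
      (1 / Real.sqrt ((n : ℝ) * Real.log (n : ℝ))) • ERW.position X₁ U G n ω) t) atTop
    (𝓝 (charFun ((multivariateGaussian (0 : EuclideanSpace ℝ (Fin d))
      (ERW.limitCov Vodd)).map id) t))
  rw [Measure.map_id, charFun_multivariateGaussian ERW.posSemidef_limitCov]
  have h := hin.tendsto_integral_exp_inner_position hV hp.2 hq.1 hδ t
  convert h using 1
  · ext n
    rw [charFun_apply, integral_map (hmeas n).aemeasurable (by fun_prop)]
    congr 1; ext ω
    rw [real_inner_smul_left, mul_comm Complex.I, one_div, inv_mul_eq_div]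
  · simp
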